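/- Let $p$ be a prime, let $k$ be a commutative reduced ring of characteristic $p$, let $n,q\ge 0$ be integers, and put $A=k[x,y]/\langle h\rangle$ with $h=x^n-y^q$. For $m\in\{1,2,\dots\}\cup\{\infty\}$, a Hasse–Schmidt derivation of $A$ over $k$ of length $m$ is a family $(D_i)_{0\le i\le m}$ (over all $i\ge 0$ if $m=\infty$) of $k$-linear maps $D_i:A\to A$ with $D_0=\mathrm{id}$ and $D_i(fg)=\sum_{a+b=i}D_a(f)D_b(g)$ for all $f,g\in A$ and all $i$. Let $\mathrm{IDer}_k(A;m)$ be the set of all $\delta\in\mathrm{Der}_k(A)$ with $\delta=D_1$ for some Hasse–Schmidt derivation $D$ of length $m$, and put $\mathrm{IDer}_k(A)=\mathrm{IDer}_k(A;\infty)$. We say that $A$ has a leap at an integer $l>1$ if $\mathrm{IDer}_k(A;l)\subsetneq\mathrm{IDer}_k(A;l-1)$. If a $k$-derivation $\delta$ of $k[x,y]$ satisfies $\delta(\langle h\rangle)\subseteq\langle h\rangle$, then $\overline\delta$ denotes the induced derivation of $A$. All spans $\langle\cdots\rangle$ of derivations below are $A$-submodules of $\mathrm{Der}_k(A)$, and it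 is part of each assertion that the derivations of $k[x,y]$ under the bars map $\langle h\rangle$ into itself. 1. If $n\neq 0$ and $q\neq 0$ in $k$, then $$\mathrm{IDer}_k(A)=\mathrm{Der}_k(A)=\langle\overline{\delta_1},\overline{\delta_2}\rangle,\qquad \delta_1=qx\,\partial_x+ny\,\partial_y,\quad \delta_2=qy^{q-1}\partial_x+nx^{n-1}\partial_y .$$ 2. If $p\mid n$ and $q=1$, then $\mathrm{IDer}_k(A)=\mathrm{Der}_k(A)=\langle\overline{\partial_x}\rangle$. 3. Suppose that $n\ge 1$, $p\mid n$, $p\nmid q$ and $q\ge 2$. Let $\alpha=\mathrm{val}_p(n)\ge 1$, $s=n/p^\alpha$, let $m\in\{1,\dots,p-1\}$ be the remainder of $q$ modulo $p$, let $\beta=\mathrm{val}_p(q-m)$ (with $\mathrm{val}_p(0)=\infty$), and let $\gamma=\lceil (q-1)/p^\alpha\rceil$. Then $$\mathrm{IDer}_k(A;i)=\langle\overline{\partial_x}\rangle\qquad\text{for } 1\le i<p^\alpha .$$ * Exceptional case: if $s=1$, $\alpha\le\beta$ and $m=1$ (then $\beta<\infty$, since $q\ge2$), then $$\mathrm{IDer}_k(A;i)=\begin{cases}\langle\overline{x\partial_x},\overline{y^{\gamma}\partial_x}\rangle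 & \text{if } p^\alpha\le i<p^{\alpha+\beta},\\ \langle\overline{x\partial_x},\overline{y^{\gamma+1}\partial_x}\rangle & \text{if } i\ge p^{\alpha+\beta}\text{ or } i=\infty,\end{cases}$$ and the leaps of $A$ are exactly $p^\alpha$ and $p^{\alpha+\beta}$. * Otherwise, $$\mathrm{IDer}_k(A;i)=\langle\overline{x\partial_x},\overline{y^{\gamma}\partial_x}\rangle\qquad\text{if } i\ge p^\alpha\text{ or } i=\infty,$$ and $p^\alpha$ is the only leap of $A$. -/

import Mathlib

open MvPolynomial

/-- A Hasse-Schmidt derivation of the `k`-algebra `A` of length `m` (for `m ≥ 1` or `m = ∞`):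
a family `(D_i)_{0 ≤ i ≤ m}` of `k`-linear maps `A → A` with `D_0 = id` and
`D_i (x y) = ∑_{a + b = i} D_a x * D_b y`. The family is indexed by all of `ℕ`, the components
beyond the length being `0`, so that an element of this type is exactly such a family. -/
structure HasseSchmidt (k A : Type*) [CommRing k] [CommRing A] [Algebra k A] (m : ℕ∞) where
  /-- the components of the Hasse-Schmidt derivation -/
  D : ℕ → A →ₗ[k] A
  D_zero : D 0 = LinearMap.id
  D_mul : ∀ i : ℕ, (i : ℕ∞) ≤ m → ∀ x y : A,
    D i (x * y) = ∑ ab ∈ Finset.HasAntidiagonal.antidiagonal i, D ab.1 x * D ab.2 y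
  D_beyond : ∀ i : ℕ, m < (i : ℕ∞) → D i = 0

/-- The set `IDer_k(A; m)` of `m`-integrable derivations (`m ≥ 1` or `m = ∞`): those `δ` that are
the component `D_1` of a Hasse-Schmidt derivation of length `m`. -/
def IDer (k A : Type*) [CommRing k] [CommRing A] [Algebra k A] (m : ℕ∞) :
    Set (Derivation k A A) :=
  {δ | ∃ E : HasseSchmidt k A m, E.D 1 = (δ : A →ₗ[k] A)}

/-- `A` has a leap on `s > 1` if `IDer_k(A; s - 1) ⊋ IDer_k(A; s)`. -/
def HasLeap (k A : Type*) [CommRing k] [CommRing A] [Algebra k A] (s : ℕ) : Prop :=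
  1 < s ∧ IDer k A (s : ℕ∞) ⊂ IDer k A ((s - 1 : ℕ) : ℕ∞)

/-- The `R`-module `Der_k(log I)` of derivations `δ` of `R` with `δ(I) ⊆ I`. -/
def derLog (k : Type*) {R : Type*} [CommRing k] [CommRing R] [Algebra k R] (I : Ideal R) :
    Submodule R (Derivation k R R) where
  carrier := {δ | ∀ f ∈ I, δ f ∈ I}
  add_mem' := fun ha hb f hf => I.add_mem (ha f hf) (hb f hf)
  zero_mem' := fun _ _ => I.zero_mem
  smul_mem' := fun c _ ha f hf => I.mul_mem_left c (ha f hf)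

theorem derLog_quotient {k R : Type*} [CommRing k] [CommRing R] [Algebra k R] {I : Ideal R}
    (δ : derLog k I) (f : R) (hf : Ideal.Quotient.mkₐ k I f = 0) :
    Ideal.Quotient.mkₐ k I (δ.1 f) = 0 := by
  simp only [Ideal.Quotient.mkₐ_eq_mk, Ideal.Quotient.eq_zero_iff_mem] at hf ⊢
  exact δ.2 f hf

/-- The derivation of `R ⧸ I` induced by an `I`-logarithmic derivation of `R`:
`a + I ↦ δ a + I`. -/
noncomputable def derBar {k R : Type*} [CommRing k] [CommRing R] [Algebra k R] {I : Ideal R}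
    (δ : derLog k I) : Derivation k (R ⧸ I) (R ⧸ I) :=
  Derivation.liftOfSurjective (f := Ideal.Quotient.mkₐ k I) (d := δ.1)
    (Ideal.Quotient.mkₐ_surjective k I) (derLog_quotient δ)

theorem derBar_mk {k R : Type*} [CommRing k] [CommRing R] [Algebra k R] {I : Ideal R}
    (δ : derLog k I) (a : R) :
    derBar δ (Ideal.Quotient.mk I a) = Ideal.Quotient.mk I (δ.1 a) :=
  Derivation.liftOfSurjective_apply (f := Ideal.Quotient.mkₐ k I) (d := δ.1)
    (Ideal.Quotient.mkₐ_surjective k I) (derLog_quotient δ) a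

/-- The ideal generated by `h = x ^ n - y ^ q` in `k[x, y]`, where `x = X 0` and `y = X 1`. -/
noncomputable def curveIdeal (k : Type*) [CommRing k] (n q : ℕ) : Ideal (MvPolynomial (Fin 2) k) :=
  Ideal.span {X 0 ^ n - X 1 ^ q}

/-- The ring `A = k[x, y] / ⟨x ^ n - y ^ q⟩`. -/
abbrev CurveRing (k : Type*) [CommRing k] (n q : ℕ) : Type _ :=
  MvPolynomial (Fin 2) k ⧸ curveIdeal k n q

/-- `δ₁ = q x ∂x + n y ∂y`. -/
noncomputable def delta1 (k : Type*) [CommRing k] (n q : ℕ) :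
    Derivation k (MvPolynomial (Fin 2) k) (MvPolynomial (Fin 2) k) :=
  ((q : MvPolynomial (Fin 2) k) * X 0) • pderiv 0 + ((n : MvPolynomial (Fin 2) k) * X 1) • pderiv 1

/-- `δ₂ = q y ^ (q - 1) ∂x + n x ^ (n - 1) ∂y` (used for `n, q ≥ 1`). -/
noncomputable def delta2 (k : Type*) [CommRing k] (n q : ℕ) :
    Derivation k (MvPolynomial (Fin 2) k) (MvPolynomial (Fin 2) k) :=
  ((q : MvPolynomial (Fin 2) k) * X 1 ^ (q - 1)) • pderiv 0 +
    ((n : MvPolynomial (Fin 2) k) * X 0 ^ (n - 1)) • pderiv 1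

/-!
A Hasse-Schmidt derivation of length `m` of `A = k[x, y] / ⟨x ^ n - y ^ q⟩` is a pair of power
series `φ = x + δ(x) t + ⋯`, `ψ = y + δ(y) t + ⋯` over `A` that satisfies `φ ^ n = ψ ^ q` up to
order `m` in `t` (`mem_IDer_curve_iff`). So everything is a question about which first order
terms extend to solutions of this equation. Hasse-Schmidt derivations can be composed and rescaled,
hence `IDer_k(A; m)` is an `A`-submodule and it suffices to integrate generators.

*Integrals.* The Euler derivation comes from the grading. All other integrals are `q`-th roots:
`φ` is chosen, and `ψ` has to be a root of `φ ^ n = y ^ q G`. If `G` is a power series over `A`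
with constant term `1`, then `G` has a `q`-th root because `q` is a unit and `A⟦t⟧` is Henselian.
In the borderline cases (the Hamiltonian derivation, and `y ^ γ ∂x` with `γ p ^ α = q - 1` and
`s ≥ 2`) the series `G` has coefficients in a larger ring `B = A + A z ⊆ A[1/y]`, where `z ^ 2 ∈ A`
and `y z ∈ A`. A root `F` of `G` over `B` suffices, since `y B ⊆ A` makes `ψ = y F` a series
over `A` (`PowerSeries.exists_pow_eq_of_sq_eq`). For `s = 1` one has `z = 1 / y`, whose square is
not in `A`, and only the truncated solution `φ = x + y ^ γ t`, `ψ = y + t ^ (p ^ α)` is left; it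
works up to the order `p ^ (α + β)`.

*Obstructions.* Let `n = p ^ α s`. By the Frobenius endomorphism the first term of `φ ^ n` after
`x ^ n` is `s x ^ (n - p ^ α) δ(x) ^ (p ^ α) t ^ (p ^ α)`, and it must be divisible by
`y ^ (q - 1)`. As `k` is reduced, this says that `δ(x)` lies in `⟨x, y ^ γ⟩`
(`exists_eq_of_mem_IDer`). In the exceptional case `n = p ^ α`, `q = 1 + p ^ β r`, the coefficient
of `t ^ (p ^ (α + β))` in `ψ ^ q = ψ (ψ ^ (p ^ β)) ^ r` produces the monomial `y ^ (q - p ^ β)`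
with coefficient `r c ^ (p ^ (α + β))`, where `c` is the leading coefficient of `δ(x)` modulo `x`;
its exponent is prime to `p` and less than `q - 1`, so `c = 0`
(`exists_eq_of_mem_IDer_exceptional`).
-/

/-! ### Operations on Hasse-Schmidt derivations -/

section HasseSchmidt

variable {k A : Type*} [CommRing k] [CommRing A] [Algebra k A] {m : ℕ∞}

theorem HasseSchmidt.coeff_mk_pow (E : HasseSchmidt k A m) (a : A) (j i : ℕ) (hi : (i : ℕ∞) ≤ m) :
    PowerSeries.coeff i ((PowerSeries.mk fun i => E.D i a) ^ (j + 1)) = E.D i (a ^ (j + 1)) := by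
  induction j generalizing i with
  | zero => simp
  | succ j ih =>
    rw [pow_succ, PowerSeries.coeff_mul, pow_succ a, E.D_mul i hi]
    refine Finset.sum_congr rfl fun ab hab => ?_
    rw [PowerSeries.coeff_mk, ih]
    have := le_of_add_le_left (Finset.HasAntidiagonal.mem_antidiagonal.1 hab).le
    exact le_trans (by exact_mod_cast this) hi

theorem HasseSchmidt.map_one (E : HasseSchmidt k A m) {i : ℕ} (hi : (i : ℕ∞) ≤ m) (h0 : i ≠ 0) :
    E.D i 1 = 0 := by
  induction i using Nat.strong_induction_on with
  | _ i ih =>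
    have h := E.D_mul i hi 1 1
    rw [Finset.Nat.sum_antidiagonal_eq_sum_range_succ_mk, Finset.sum_range_succ] at h
    obtain ⟨j, rfl⟩ := Nat.exists_eq_succ_of_ne_zero h0
    rw [Finset.sum_range_succ'] at h
    rw [Finset.sum_eq_zero] at h
    · simpa [E.D_zero] using h
    · intro l hl
      rw [Finset.mem_range] at hl
      rw [ih (l + 1) (by omega) (le_trans (by exact_mod_cast (by omega)) hi) (by omega)]
      simp

/-- Restriction of a Hasse-Schmidt derivation to a smaller length. -/
def HasseSchmidt.trunc (E : HasseSchmidt k A m) {l : ℕ∞} (h : l ≤ m) : HasseSchmidt k A l where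
  D i := open Classical in if (i : ℕ∞) ≤ l then E.D i else 0
  D_zero := by simp [E.D_zero]
  D_mul i hi x y := by
    rw [if_pos hi, E.D_mul i (hi.trans h)]
    refine Finset.sum_congr rfl fun ab hab => ?_
    have h1 := le_of_add_le_left (Finset.HasAntidiagonal.mem_antidiagonal.1 hab).le
    have h2 := le_of_add_le_right (Finset.HasAntidiagonal.mem_antidiagonal.1 hab).le
    rw [if_pos (le_trans (by exact_mod_cast h1) hi), if_pos (le_trans (by exact_mod_cast h2) hi)]
  D_beyond i hi := if_neg hi.not_ge

/-- The composition of two Hasse-Schmidt derivations, given by composing the ring homomorphisms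
`A → A⟦t⟧` that they stand for. -/
def HasseSchmidt.comp (E F : HasseSchmidt k A m) : HasseSchmidt k A m where
  D i := open Classical in if (i : ℕ∞) ≤ m then
    ∑ ab ∈ Finset.HasAntidiagonal.antidiagonal i, E.D ab.1 ∘ₗ F.D ab.2 else 0
  D_zero := by simp [E.D_zero, F.D_zero]
  D_mul i hi x y := by
    have key : ∀ ab ∈ Finset.HasAntidiagonal.antidiagonal i, ((ab.1 : ℕ) : ℕ∞) ≤ m ∧ ((ab.2 : ℕ) : ℕ∞) ≤ m := by
      intro ab hab
      have h1 := le_of_add_le_left (Finset.HasAntidiagonal.mem_antidiagonal.1 hab).le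
      have h2 := le_of_add_le_right (Finset.HasAntidiagonal.mem_antidiagonal.1 hab).le
      exact ⟨le_trans (by exact_mod_cast h1) hi, le_trans (by exact_mod_cast h2) hi⟩
    rw [if_pos hi]
    calc _ = ∑ ab ∈ Finset.HasAntidiagonal.antidiagonal i, ∑ cd ∈ Finset.HasAntidiagonal.antidiagonal ab.2,
          ∑ ef ∈ Finset.HasAntidiagonal.antidiagonal ab.1,
            E.D ef.1 (F.D cd.1 x) * E.D ef.2 (F.D cd.2 y) := by
          rw [LinearMap.sum_apply]
          refine Finset.sum_congr rfl fun ab hab => ?_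
          rw [LinearMap.comp_apply, F.D_mul _ (key ab hab).2, map_sum]
          exact Finset.sum_congr rfl fun cd _ => E.D_mul _ (key ab hab).1 _ _
      _ = ∑ uv ∈ Finset.HasAntidiagonal.antidiagonal i, ∑ ec ∈ Finset.HasAntidiagonal.antidiagonal uv.1,
          ∑ fd ∈ Finset.HasAntidiagonal.antidiagonal uv.2,
            E.D ec.1 (F.D ec.2 x) * E.D fd.1 (F.D fd.2 y) := by
          simp only [Finset.sum_sigma']
          refine Finset.sum_nbij'
            (fun t => ⟨(t.2.2.1 + t.2.1.1, t.2.2.2 + t.2.1.2),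
              ⟨(t.2.2.1, t.2.1.1), (t.2.2.2, t.2.1.2)⟩⟩)
            (fun t => ⟨(t.2.1.1 + t.2.2.1, t.2.1.2 + t.2.2.2),
              ⟨(t.2.1.2, t.2.2.2), (t.2.1.1, t.2.2.1)⟩⟩)
            ?_ ?_ ?_ ?_ ?_
          · rintro ⟨⟨a, b⟩, ⟨c, d⟩, ⟨e, f⟩⟩ h
            simp only [Finset.mem_sigma, Finset.HasAntidiagonal.mem_antidiagonal] at h ⊢
            exact ⟨by omega, trivial, trivial⟩
          · rintro ⟨⟨a, b⟩, ⟨c, d⟩, ⟨e, f⟩⟩ h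
            simp only [Finset.mem_sigma, Finset.HasAntidiagonal.mem_antidiagonal] at h ⊢
            exact ⟨by omega, trivial, trivial⟩
          · rintro ⟨⟨a, b⟩, ⟨c, d⟩, ⟨e, f⟩⟩ h
            simp only [Finset.mem_sigma, Finset.HasAntidiagonal.mem_antidiagonal] at h ⊢
            obtain ⟨h1, h2, h3⟩ := h
            subst h2 h3
            rfl
          · rintro ⟨⟨a, b⟩, ⟨c, d⟩, ⟨e, f⟩⟩ h
            simp only [Finset.mem_sigma, Finset.HasAntidiagonal.mem_antidiagonal] at h ⊢
            obtain ⟨h1, h2, h3⟩ := h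
            subst h2 h3
            rfl
          · rintro ⟨⟨a, b⟩, ⟨c, d⟩, ⟨e, f⟩⟩ h
            rfl
      _ = _ := by
          refine Finset.sum_congr rfl fun ab hab => ?_
          rw [if_pos (key ab hab).1, if_pos (key ab hab).2, LinearMap.sum_apply,
            LinearMap.sum_apply, Finset.sum_mul_sum]
          rfl
  D_beyond i hi := if_neg hi.not_ge

/-- Rescaling `t ↦ a t` of a Hasse-Schmidt derivation. -/
def HasseSchmidt.rescale (a : A) (E : HasseSchmidt k A m) : HasseSchmidt k A m where
  D i := a ^ i • E.D i
  D_zero := by simp [E.D_zero]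
  D_mul i hi x y := by
    rw [LinearMap.smul_apply, E.D_mul i hi, smul_eq_mul, Finset.mul_sum]
    refine Finset.sum_congr rfl fun ab hab => ?_
    rw [LinearMap.smul_apply, LinearMap.smul_apply, smul_eq_mul, smul_eq_mul,
      ← Finset.HasAntidiagonal.mem_antidiagonal.1 hab]
    ring
  D_beyond i hi := by rw [E.D_beyond i hi, smul_zero]

theorem IDer_anti {l : ℕ∞} (hl : 1 ≤ l) (h : l ≤ m) : IDer k A m ⊆ IDer k A l := by
  rintro δ ⟨E, hE⟩
  refine ⟨E.trunc h, ?_⟩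
  rw [← hE]
  exact if_pos (by exact_mod_cast hl)

theorem add_mem_IDer (hm : 1 ≤ m) {δ ε : Derivation k A A} (hδ : δ ∈ IDer k A m)
    (hε : ε ∈ IDer k A m) : δ + ε ∈ IDer k A m := by
  obtain ⟨E, hE⟩ := hδ
  obtain ⟨F, hF⟩ := hε
  refine ⟨E.comp F, ?_⟩
  have h1 : (E.comp F).D 1 = ∑ ab ∈ Finset.HasAntidiagonal.antidiagonal 1, E.D ab.1 ∘ₗ F.D ab.2 :=
    if_pos (by exact_mod_cast hm)
  rw [h1, Finset.Nat.antidiagonal_succ]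
  simp only [Finset.Nat.antidiagonal_zero, Finset.map_singleton, Finset.sum_cons,
    Finset.sum_singleton, Function.Embedding.prodMap, Function.Embedding.coeFn_mk, Prod.map,
    E.D_zero, F.D_zero, LinearMap.id_comp, LinearMap.comp_id, hF, Nat.succ_eq_add_one, zero_add,
    Function.Embedding.refl_apply, hE]
  rw [add_comm]
  rfl

theorem smul_mem_IDer (a : A) {δ : Derivation k A A} (hδ : δ ∈ IDer k A m) :
    a • δ ∈ IDer k A m := by
  obtain ⟨E, hE⟩ := hδ
  refine ⟨E.rescale a, ?_⟩
  change a ^ 1 • E.D 1 = _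
  rw [hE, pow_one]
  rfl

variable (k A) in
/-- `IDer_k(A; m)` as an `A`-submodule of `Der_k(A)`. -/
def IDerSubmodule (m : ℕ∞) (hm : 1 ≤ m) : Submodule A (Derivation k A A) where
  carrier := IDer k A m
  add_mem' := add_mem_IDer hm
  zero_mem' := by
    refine ⟨⟨fun i => if i = 0 then LinearMap.id else 0, if_pos rfl, ?_, ?_⟩, ?_⟩
    · intro i _ x y
      rw [Finset.sum_eq_single (0, i)]
      · by_cases h : i = 0 <;> simp [h]
      · rintro ⟨a, b⟩ hab hne
        have : a ≠ 0 := by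
          rintro rfl
          simp at hab
          exact hne (by rw [hab])
        simp [this]
      · simp
    · rintro i hi
      refine if_neg ?_
      rintro rfl
      simp at hi
    · simp
  smul_mem' a _ h := smul_mem_IDer a h

theorem span_subset_IDer (hm : 1 ≤ m) {S : Set (Derivation k A A)} (h : S ⊆ IDer k A m) :
    (Submodule.span A S : Set (Derivation k A A)) ⊆ IDer k A m :=
  (Submodule.span_le (p := IDerSubmodule k A m hm)).2 h

/-- A homomorphism `R → (R ⧸ I)⟦t⟧` that is the projection at `t = 0` and kills `I` up to order
`m` induces a Hasse-Schmidt derivation of `R ⧸ I` of length `m`. -/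
theorem HasseSchmidt.exists_of_algHom {R : Type*} [CommRing R] [Algebra k R] {I : Ideal R}
    (Φ : R →ₐ[k] PowerSeries (R ⧸ I))
    (h0 : ∀ f, PowerSeries.coeff 0 (Φ f) = Ideal.Quotient.mk I f)
    (hker : ∀ i : ℕ, (i : ℕ∞) ≤ m → ∀ f ∈ I, PowerSeries.coeff i (Φ f) = 0) :
    ∃ E : HasseSchmidt k (R ⧸ I) m, ∀ i : ℕ, (i : ℕ∞) ≤ m → ∀ f,
      E.D i (Ideal.Quotient.mk I f) = PowerSeries.coeff i (Φ f) := by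
  classical
  let L : ℕ → R →ₗ[k] R ⧸ I := fun i =>
    ((PowerSeries.coeff i : PowerSeries (R ⧸ I) →ₗ[_] _).restrictScalars k) ∘ₗ Φ.toLinearMap
  let D : ℕ → R ⧸ I →ₗ[k] R ⧸ I := fun i =>
    if hi : (i : ℕ∞) ≤ m then
      (Submodule.liftQ (I.restrictScalars k) (L i) (hker i hi)) ∘ₗ
        (Submodule.Quotient.restrictScalarsEquiv k I).symm.toLinearMap
    else 0
  have hD : ∀ i : ℕ, (i : ℕ∞) ≤ m → ∀ f,
      D i (Ideal.Quotient.mk I f) = PowerSeries.coeff i (Φ f) := by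
    intro i hi f
    simp only [D, dif_pos hi]
    rfl
  refine ⟨⟨D, ?_, ?_, ?_⟩, hD⟩
  · apply LinearMap.ext
    intro a
    obtain ⟨a, rfl⟩ := Ideal.Quotient.mk_surjective a
    rw [hD 0 (by simp), h0]; rfl
  · intro i hi a b
    obtain ⟨a, rfl⟩ := Ideal.Quotient.mk_surjective a
    obtain ⟨b, rfl⟩ := Ideal.Quotient.mk_surjective b
    rw [← map_mul, hD i hi, map_mul, PowerSeries.coeff_mul]
    refine Finset.sum_congr rfl fun ab hab => ?_
    have h1 := le_of_add_le_left (Finset.HasAntidiagonal.mem_antidiagonal.1 hab).le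
    have h2 := le_of_add_le_right (Finset.HasAntidiagonal.mem_antidiagonal.1 hab).le
    rw [hD _ (le_trans (by exact_mod_cast h1) hi), hD _ (le_trans (by exact_mod_cast h2) hi)]
  · intro i hi
    exact dif_neg hi.not_ge

end HasseSchmidt

/-! ### Hasse-Schmidt derivations of the curve -/

section Curve

variable (k : Type*) [CommRing k] (n q : ℕ)

/-- The class of `x` in `k[x, y] / ⟨x ^ n - y ^ q⟩`. -/
noncomputable def curveX : CurveRing k n q := Ideal.Quotient.mk _ (X 0)

/-- The class of `y` in `k[x, y] / ⟨x ^ n - y ^ q⟩`. -/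
noncomputable def curveY : CurveRing k n q := Ideal.Quotient.mk _ (X 1)

theorem curveX_pow : curveX k n q ^ n = curveY k n q ^ q := by
  rw [curveX, curveY, ← map_pow, ← map_pow]
  exact Ideal.Quotient.eq.2 (Ideal.subset_span rfl)

variable {k n q}

theorem curve_derivation_ext {δ ε : Derivation k (CurveRing k n q) (CurveRing k n q)}
    (hx : δ (curveX k n q) = ε (curveX k n q)) (hy : δ (curveY k n q) = ε (curveY k n q)) :
    δ = ε := by
  have : δ.compAlgebraMap (MvPolynomial (Fin 2) k) = ε.compAlgebraMap _ := by
    apply MvPolynomial.derivation_ext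
    intro i
    fin_cases i
    · exact hx
    · exact hy
  ext a
  obtain ⟨a, rfl⟩ := Ideal.Quotient.mk_surjective a
  exact DFunLike.congr_fun this a

/-- A Hasse-Schmidt derivation of the curve is a pair of power series that reduces to `(x, y)` at
`t = 0` and satisfies the equation of the curve up to the given order. -/
theorem mem_IDer_curve_iff {m : ℕ∞} (hm : 1 ≤ m)
    (δ : Derivation k (CurveRing k n q) (CurveRing k n q)) :
    δ ∈ IDer k (CurveRing k n q) m ↔ ∃ φ ψ : PowerSeries (CurveRing k n q),
      PowerSeries.constantCoeff φ = curveX k n q ∧ PowerSeries.constantCoeff ψ = curveY k n q ∧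
      PowerSeries.coeff 1 φ = δ (curveX k n q) ∧ PowerSeries.coeff 1 ψ = δ (curveY k n q) ∧
      ∀ i : ℕ, (i : ℕ∞) ≤ m → PowerSeries.coeff i (φ ^ n) = PowerSeries.coeff i (ψ ^ q) := by
  constructor
  · rintro ⟨E, hE⟩
    refine ⟨.mk fun i => E.D i (curveX k n q),
      .mk fun i => E.D i (curveY k n q), ?_, ?_, ?_, ?_, ?_⟩
    · simp [← PowerSeries.coeff_zero_eq_constantCoeff_apply, E.D_zero]
    · simp [← PowerSeries.coeff_zero_eq_constantCoeff_apply, E.D_zero]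
    · rw [PowerSeries.coeff_mk, hE]; rfl
    · rw [PowerSeries.coeff_mk, hE]; rfl
    · have key : ∀ (a : CurveRing k n q) (j i : ℕ) (hi : (i : ℕ∞) ≤ m),
          PowerSeries.coeff i ((PowerSeries.mk fun i => E.D i a) ^ j) = E.D i (a ^ j) := by
        intro a j i hi
        rcases j with _ | j
        · rw [pow_zero, pow_zero, PowerSeries.coeff_one]
          split_ifs with h
          · rw [h, E.D_zero]; rfl
          · exact (E.map_one hi h).symm
        · exact E.coeff_mk_pow a j i hi
      intro i hi
      rw [key _ _ _ hi, key _ _ _ hi, curveX_pow]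
  · rintro ⟨φ, ψ, hφ, hψ, hφ1, hψ1, h⟩
    let Φ : MvPolynomial (Fin 2) k →ₐ[k] PowerSeries (CurveRing k n q) := aeval ![φ, ψ]
    have hΦX : Φ (X 0) = φ := by simp [Φ]
    have hΦY : Φ (X 1) = ψ := by simp [Φ]
    have h0 : ∀ f, PowerSeries.coeff 0 (Φ f) = Ideal.Quotient.mk _ f := by
      intro f
      have : (PowerSeries.constantCoeff (R := CurveRing k n q)).comp (Φ : _ →+* _) =
          Ideal.Quotient.mk (curveIdeal k n q) := by
        apply MvPolynomial.ringHom_ext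
        · intro r
          simp [Φ, PowerSeries.algebraMap_apply]
          rfl
        · intro i
          fin_cases i
          · simpa [Φ, curveX] using hφ
          · simpa [Φ, curveY] using hψ
      rw [PowerSeries.coeff_zero_eq_constantCoeff_apply]
      exact RingHom.congr_fun this f
    have h1 : ∀ f, PowerSeries.coeff 1 (Φ f) = δ (Ideal.Quotient.mk _ f) := by
      intro f
      induction f using MvPolynomial.induction_on with
      | C r =>
        have e1 : Φ (C r) = PowerSeries.C (algebraMap k _ r) := by
          simp [Φ, PowerSeries.algebraMap_apply]
        have e2 : Ideal.Quotient.mk (curveIdeal k n q) (C r) = algebraMap k _ r := rfl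
        rw [e1, e2, δ.map_algebraMap, PowerSeries.coeff_C]
        simp
      | add f g hf hg => simp [hf, hg]
      | mul_X f i hf =>
        have hX : PowerSeries.coeff 1 (Φ (X i)) = δ (Ideal.Quotient.mk _ (X i)) := by
          fin_cases i
          · exact (congrArg _ hΦX).trans hφ1
          · exact (congrArg _ hΦY).trans hψ1
        rw [map_mul, map_mul (Ideal.Quotient.mk _), PowerSeries.coeff_mul,
          Finset.Nat.antidiagonal_succ]
        simp only [Finset.Nat.antidiagonal_zero, Finset.map_singleton, Finset.sum_cons,
          Finset.sum_singleton, Function.Embedding.prodMap, Function.Embedding.coeFn_mk, Prod.map,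
          Nat.succ_eq_add_one, zero_add, Function.Embedding.refl_apply]
        rw [h0, h0, hX, hf, δ.leibniz, smul_eq_mul, smul_eq_mul]
        ring
    have hker : ∀ i : ℕ, (i : ℕ∞) ≤ m → ∀ f ∈ curveIdeal k n q, PowerSeries.coeff i (Φ f) = 0 := by
      intro i hi f hf
      obtain ⟨g, rfl⟩ := Ideal.mem_span_singleton.1 hf
      rw [map_mul, PowerSeries.coeff_mul]
      refine Finset.sum_eq_zero fun ab hab => ?_
      have h1 := le_of_add_le_left (Finset.HasAntidiagonal.mem_antidiagonal.1 hab).le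
      rw [map_sub, map_pow, map_pow, hΦX, hΦY, map_sub,
        h _ (le_trans (by exact_mod_cast h1) hi), sub_self, zero_mul]
    obtain ⟨E, hE⟩ := HasseSchmidt.exists_of_algHom Φ h0 hker
    refine ⟨E, LinearMap.ext fun a => ?_⟩
    obtain ⟨a, rfl⟩ := Ideal.Quotient.mk_surjective a
    rw [hE 1 (by exact_mod_cast hm), h1]; rfl

end Curve

/-! ### Divisibility by powers of a variable -/

section Monomials

variable {σ k : Type*} [CommRing k]

theorem MvPolynomial.coeff_X_pow_mul_of_lt {j : σ} {b : ℕ} {m : σ →₀ ℕ} (h : m j < b)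
    (G : MvPolynomial σ k) : coeff m (X j ^ b * G) = 0 := by
  classical
  rw [X_pow_eq_monomial, coeff_monomial_mul', if_neg]
  intro hle
  have := hle j
  rw [Finsupp.single_eq_same] at this
  omega

theorem MvPolynomial.X_pow_dvd_of_coeff {j : σ} {b : ℕ} {F : MvPolynomial σ k}
    (h : ∀ m : σ →₀ ℕ, m j < b → coeff m F = 0) : X j ^ b ∣ F := by
  rw [X_pow_eq_monomial, monomial_one_dvd_iff_modMonomial_eq_zero]
  ext m
  by_cases hm : Finsupp.single j b ≤ m
  · rw [coeff_modMonomial_of_le _ hm, coeff_zero]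
  · rw [coeff_modMonomial_of_not_le _ hm, coeff_zero]
    refine h m (not_le.1 fun hle => hm ?_)
    rwa [Finsupp.single_le_iff]

/-- Over any coefficient ring, a power of one variable is a nonzerodivisor modulo a power of
another. -/
theorem MvPolynomial.X_pow_dvd_of_X_pow_mul_eq {i j : σ} (hij : i ≠ j) {a b : ℕ}
    {F G : MvPolynomial σ k} (h : X i ^ a * F = X j ^ b * G) : X j ^ b ∣ F := by
  classical
  refine X_pow_dvd_of_coeff fun m hm => ?_
  have h1 : coeff (Finsupp.single i a + m) (X i ^ a * F) = coeff m F := by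
    rw [X_pow_eq_monomial, coeff_monomial_mul, one_mul]
  rw [← h1, h, coeff_X_pow_mul_of_lt]
  simpa [hij] using hm

theorem MvPolynomial.coeff_aeval_X (j : σ) (u : Polynomial k) (e : ℕ) :
    coeff (Finsupp.single j e) (Polynomial.aeval (X j : MvPolynomial σ k) u) = u.coeff e := by
  classical
  induction u using Polynomial.induction_on' with
  | add u v hu hv => simp [hu, hv]
  | monomial a r =>
    rw [Polynomial.aeval_monomial, algebraMap_eq, coeff_C_mul, coeff_X_pow,
      Polynomial.coeff_monomial]
    by_cases h : a = e
    · simp [h]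
    · rw [if_neg h, if_neg, mul_zero]
      intro h'
      exact h (by simpa using DFunLike.congr_fun h' j)

end Monomials

/-! ### The coordinate ring of the curve -/

section CurveAlgebra

variable {k : Type*} [CommRing k] {n q : ℕ}

theorem curveY_mul_left_cancel (hq : q ≠ 0) {a b : CurveRing k n q}
    (h : curveY k n q * a = curveY k n q * b) : a = b := by
  obtain ⟨a, rfl⟩ := Ideal.Quotient.mk_surjective a
  obtain ⟨b, rfl⟩ := Ideal.Quotient.mk_surjective b
  rw [curveY, ← map_mul, ← map_mul, Ideal.Quotient.eq] at h
  rw [Ideal.Quotient.eq]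
  obtain ⟨c, hc⟩ := Ideal.mem_span_singleton.1 h
  obtain ⟨r, rfl⟩ : ∃ r, q = r + 1 := ⟨q - 1, by omega⟩
  have h1 : X 0 ^ n * c = X 1 ^ 1 * (a - b + X 1 ^ r * c) := by
    linear_combination -hc
  obtain ⟨c', rfl⟩ := X_pow_dvd_of_X_pow_mul_eq (by decide) h1
  refine Ideal.mem_span_singleton.2 ⟨c', ?_⟩
  apply (isRegular_X (R := k) (n := (1 : Fin 2))).left
  change X 1 * _ = X 1 * _
  linear_combination hc

theorem curveY_pow_cancel (hq : q ≠ 0) (j : ℕ) {a b : CurveRing k n q}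
    (h : curveY k n q ^ j * a = curveY k n q ^ j * b) : a = b := by
  induction j with
  | zero => simpa using h
  | succ j ih => exact ih (curveY_mul_left_cancel hq (by linear_combination h))

/-- For fixed `e < n` and `N ≤ q`, the monomials `x ^ e y ^ j` with `j < N` are linearly independent
modulo `y ^ N`. -/
theorem coeff_eq_zero_of_curveX_pow_mul_eq {e N : ℕ} (he : e < n) (hN : N ≤ q) {u : Polynomial k}
    {b : CurveRing k n q}
    (h : curveX k n q ^ e * Polynomial.aeval (curveY k n q) u = curveY k n q ^ N * b)
    {j : ℕ} (hj : j < N) : u.coeff j = 0 := by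
  classical
  obtain ⟨b, rfl⟩ := Ideal.Quotient.mk_surjective b
  have h1 : Polynomial.aeval (curveY k n q) u =
      Ideal.Quotient.mk (curveIdeal k n q) (Polynomial.aeval (X 1) u) :=
    Polynomial.aeval_algHom_apply (Ideal.Quotient.mkₐ k (curveIdeal k n q)) (X 1) u
  rw [h1, curveX, curveY, ← map_pow, ← map_pow, ← map_mul, ← map_mul, Ideal.Quotient.eq] at h
  obtain ⟨c, hc⟩ := Ideal.mem_span_singleton.1 h
  have hc' : X 0 ^ e * Polynomial.aeval (X 1) u =
      X 1 ^ N * (b - X 1 ^ (q - N) * c) + X 0 ^ n * c := by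
    obtain ⟨d, rfl⟩ := Nat.exists_eq_add_of_le hN
    rw [Nat.add_sub_cancel_left]
    linear_combination hc
  have h2 := congrArg (coeff (Finsupp.single 0 e + Finsupp.single 1 j)) hc'
  rwa [X_pow_eq_monomial, coeff_monomial_mul, one_mul, coeff_aeval_X, coeff_add,
    coeff_X_pow_mul_of_lt, coeff_X_pow_mul_of_lt, add_zero] at h2
  · simpa using he
  · simpa using hj

/-- Every element of the coordinate ring is a polynomial in `y` modulo `x`. -/
theorem exists_eq_aeval_curveY_add (a : CurveRing k n q) :
    ∃ (u : Polynomial k) (b : CurveRing k n q),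
      a = Polynomial.aeval (curveY k n q) u + curveX k n q * b := by
  obtain ⟨f, rfl⟩ := Ideal.Quotient.mk_surjective a
  induction f using MvPolynomial.induction_on with
  | C r =>
    refine ⟨Polynomial.C r, 0, ?_⟩
    rw [Polynomial.aeval_C, mul_zero, add_zero]
    rfl
  | add f g hf hg =>
    obtain ⟨u, b, hu⟩ := hf
    obtain ⟨v, c, hv⟩ := hg
    refine ⟨u + v, b + c, ?_⟩
    rw [map_add, hu, hv, map_add]
    ring
  | mul_X f i hf =>
    obtain ⟨u, b, hu⟩ := hf
    rw [map_mul, hu]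
    fin_cases i
    · refine ⟨0, Polynomial.aeval (curveY k n q) u + curveX k n q * b, ?_⟩
      rw [map_zero, zero_add, mul_comm]
      rfl
    · refine ⟨u * Polynomial.X, b * curveY k n q, ?_⟩
      rw [map_mul, Polynomial.aeval_X]
      change _ * curveY k n q = _
      ring

theorem algebraMap_curveRing_injective (hn : n ≠ 0) (hq : q ≠ 0) :
    Function.Injective (algebraMap k (CurveRing k n q)) := by
  rw [injective_iff_map_eq_zero]
  intro c hc
  have := coeff_eq_zero_of_curveX_pow_mul_eq (k := k) (n := n) (q := q) (e := 0) (N := 1)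
    (u := Polynomial.C c) (b := 0) (by omega) (by omega) (by simp [hc]) zero_lt_one
  simpa using this

end CurveAlgebra

/-! ### Roots of power series -/

section Roots

/-- The Henselian property of `R⟦t⟧` gives a `q`-th root of a series with constant term `1`. -/
theorem PowerSeries.exists_pow_eq_of_isUnit {R : Type*} [CommRing R] {q : ℕ}
    (hq : IsUnit (q : R)) {G : PowerSeries R} (hG : PowerSeries.constantCoeff G = 1) :
    ∃ F : PowerSeries R, PowerSeries.constantCoeff F = 1 ∧ F ^ q = G := by
  rcases subsingleton_or_nontrivial R with hR | hR
  · exact ⟨G, hG, Subsingleton.elim _ _⟩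
  have hq0 : q ≠ 0 := by
    rintro rfl
    simp at hq
  let I : Ideal (PowerSeries R) := Ideal.span {PowerSeries.X}
  obtain ⟨F, hF, hF1⟩ := HenselianRing.is_henselian (I := I) (Polynomial.X ^ q - Polynomial.C G)
    (Polynomial.monic_X_pow_sub_C G hq0) 1 (by
      simp only [Polynomial.eval_sub, Polynomial.eval_pow, Polynomial.eval_X, one_pow,
        Polynomial.eval_C]
      rw [Ideal.mem_span_singleton, PowerSeries.X_dvd_iff]
      simp [hG]) (by
      simp only [Polynomial.derivative_sub, Polynomial.derivative_X_pow, Polynomial.derivative_C,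
        sub_zero, Polynomial.eval_mul, Polynomial.eval_pow, Polynomial.eval_X, one_pow, mul_one]
      apply IsUnit.map
      have := hq.map (PowerSeries.C (R := R))
      simpa using this)
  refine ⟨F, ?_, ?_⟩
  · rw [Ideal.mem_span_singleton, PowerSeries.X_dvd_iff, map_sub, sub_eq_zero] at hF1
    simpa using hF1
  · simpa [sub_eq_zero] using hF

/-- If `G` is a power series over a ring `B ⊇ A` with `y B ⊆ A`, then `y ^ q G` has a `q`-th root
over `A`, although `G` itself need not have one. -/
theorem PowerSeries.exists_pow_eq_of_conductor {A B : Type*} [CommRing A] [CommRing B]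
    (ι : A →+* B) (hι : Function.Injective ι) (y : A) (hB : ∀ b, ∃ a, ι a = ι y * b) {q : ℕ}
    (hq : IsUnit (q : A)) {G : PowerSeries B} (hG : PowerSeries.constantCoeff G = 1)
    {Φ : PowerSeries A}
    (hΦ : PowerSeries.map ι Φ = PowerSeries.C (ι y) ^ q * G) :
    ∃ ψ : PowerSeries A, PowerSeries.constantCoeff ψ = y ∧ ψ ^ q = Φ ∧
      ι (q * PowerSeries.coeff 1 ψ) = ι y * PowerSeries.coeff 1 G := by
  obtain ⟨F, hF1, rfl⟩ := exists_pow_eq_of_isUnit (by simpa using hq.map ι) hG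
  choose g hg using hB
  have hψ : PowerSeries.map ι (PowerSeries.mk fun i => g (PowerSeries.coeff i F)) =
      PowerSeries.C (ι y) * F := by
    ext i
    rw [PowerSeries.coeff_map, PowerSeries.coeff_mk, hg, PowerSeries.coeff_C_mul]
  refine ⟨PowerSeries.mk fun i => g (PowerSeries.coeff i F), ?_, ?_, ?_⟩
  · apply hι
    rw [← PowerSeries.coeff_zero_eq_constantCoeff_apply, PowerSeries.coeff_mk, hg,
      PowerSeries.coeff_zero_eq_constantCoeff_apply, hF1, mul_one]
  · apply PowerSeries.map_injective ι hι
    rw [map_pow, hψ, hΦ, mul_pow]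
  · rw [map_mul, PowerSeries.coeff_mk, hg, PowerSeries.coeff_one_pow, hF1, one_pow, map_natCast]
    ring

/-- The root of `exists_pow_eq_of_conductor` for `B = A + A z ⊆ A[1/y]`, where `z = c / y` and
`z ^ 2 = d` lies in `A`. The series `G₀ + z G₁` has coefficients in `B`. -/
theorem PowerSeries.exists_pow_eq_of_sq_eq {A : Type*} [CommRing A] {y c d : A}
    (hy : ∀ a b, y * a = y * b → a = b) (hcd : c ^ 2 = y ^ 2 * d) {q : ℕ} (hq : IsUnit (q : A))
    {G₀ G₁ Φ : PowerSeries A} (h₀ : PowerSeries.constantCoeff G₀ = 1)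
    (h₁ : PowerSeries.constantCoeff G₁ = 0)
    (hΦ : PowerSeries.C y * Φ =
      PowerSeries.C y ^ q * (PowerSeries.C y * G₀ + PowerSeries.C c * G₁)) :
    ∃ ψ : PowerSeries A, PowerSeries.constantCoeff ψ = y ∧ ψ ^ q = Φ ∧
      q * PowerSeries.coeff 1 ψ = y * PowerSeries.coeff 1 G₀ + c * PowerSeries.coeff 1 G₁ := by
  let L := Localization.Away y
  let j : A →+* L := algebraMap A L
  have hyu : IsUnit (j y) := IsLocalization.Away.algebraMap_isUnit y
  have hj : Function.Injective j := by
    apply IsLocalization.injective (M := Submonoid.powers y)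
    rw [Submonoid.powers_le, mem_nonZeroDivisors_iff_right]
    intro a ha
    exact hy a 0 (by rw [mul_comm, ha, mul_zero])
  obtain ⟨z, hz⟩ : ∃ z, j y * z = j c :=
    ⟨j c * (IsLocalization.Away.invSelf y), by
      rw [mul_left_comm, IsLocalization.Away.mul_invSelf, mul_one]⟩
  have hz2 : z ^ 2 = j d := by
    apply (hyu.pow 2).mul_left_cancel
    rw [← mul_pow, hz, ← map_pow, hcd, map_mul, map_pow]
  let B : Subring L :=
    { carrier := {l | ∃ a b, l = j a + j b * z}
      mul_mem' := by
        rintro _ _ ⟨a, b, rfl⟩ ⟨a', b', rfl⟩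
        refine ⟨a * a' + b * b' * d, a * b' + b * a', ?_⟩
        simp only [map_add, map_mul, ← hz2]
        ring
      one_mem' := ⟨1, 0, by simp⟩
      add_mem' := by
        rintro _ _ ⟨a, b, rfl⟩ ⟨a', b', rfl⟩
        refine ⟨a + a', b + b', ?_⟩
        simp only [map_add]
        ring
      zero_mem' := ⟨0, 0, by simp⟩
      neg_mem' := by
        rintro _ ⟨a, b, rfl⟩
        refine ⟨-a, -b, ?_⟩
        simp only [map_neg]
        ring }
  let ι : A →+* B := j.codRestrict B fun a => ⟨a, 0, by simp⟩
  have hι : Function.Injective ι := fun a b h => hj (congrArg Subtype.val h)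
  let w : B := ⟨z, 0, 1, by simp⟩
  have hw : ι y * w = ι c := Subtype.ext hz
  have hyB : ∀ a b : B, ι y * a = ι y * b → a = b := fun a b h =>
    Subtype.ext (hyu.mul_left_cancel (congrArg Subtype.val h))
  obtain ⟨ψ, hψ0, hψ, hψ1⟩ := exists_pow_eq_of_conductor ι hι y (q := q) (Φ := Φ)
    (G := PowerSeries.map ι G₀ + PowerSeries.C w * PowerSeries.map ι G₁) (by
      rintro ⟨_, a, b, rfl⟩
      refine ⟨y * a + c * b, Subtype.ext ?_⟩
      change j (y * a + c * b) = j y * (j a + j b * z)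
      rw [map_add, map_mul, map_mul, ← hz]
      ring) hq (by
      rw [← PowerSeries.coeff_zero_eq_constantCoeff_apply] at h₀ h₁ ⊢
      rw [map_add, PowerSeries.coeff_C_mul, PowerSeries.coeff_map, PowerSeries.coeff_map, h₀, h₁]
      simp) (by
      ext1 i
      apply hyB
      rw [← PowerSeries.coeff_C_mul, ← PowerSeries.coeff_C_mul]
      congr 1
      have := congrArg (PowerSeries.map ι) hΦ
      simp only [map_mul, map_add, map_pow, PowerSeries.map_C] at this
      rw [this, ← hw, map_mul]
      ring)
  refine ⟨ψ, hψ0, hψ, hι ?_⟩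
  rw [hψ1]
  simp only [map_mul, map_add, ← hw, PowerSeries.coeff_map, PowerSeries.coeff_C_mul]
  ring

/-- A `q`-th root of `(U + y ^ (q - 1) T) ^ s` when `U ^ s = y ^ q`. Formally it is
`y (1 + s z T + y ^ (q - 2) T ^ 2 (⋯)) ^ (1 / q)` with `z = U ^ (s - 1) / y`, and
`z ^ 2 = y ^ (q - 2) U ^ (s - 2)`. -/
theorem PowerSeries.exists_pow_eq_add_pow {A : Type*} [CommRing A] {y U : A}
    (hy : ∀ a b, y * a = y * b → a = b) {q s : ℕ} (hq : IsUnit (q : A)) (hq2 : 2 ≤ q)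
    (hs : 2 ≤ s) (hU : U ^ s = y ^ q) {T : PowerSeries A} (hT : PowerSeries.constantCoeff T = 0) :
    ∃ ψ : PowerSeries A, PowerSeries.constantCoeff ψ = y ∧
      ψ ^ q = (PowerSeries.C U + PowerSeries.C (y ^ (q - 1)) * T) ^ s ∧
      q * PowerSeries.coeff 1 ψ = s * U ^ (s - 1) * PowerSeries.coeff 1 T := by
  obtain ⟨K, hK⟩ := Polynomial.powAddExpansion (PowerSeries.C U)
    (PowerSeries.C (y ^ (q - 1)) * T) s
  obtain ⟨q, rfl⟩ := Nat.exists_eq_add_of_le' hq2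
  obtain ⟨s, rfl⟩ := Nat.exists_eq_add_of_le' hs
  obtain ⟨ψ, h0, h1, h2⟩ := exists_pow_eq_of_sq_eq (y := y) (c := U ^ (s + 1)) (d := y ^ q * U ^ s)
    (q := q + 2) (G₀ := 1 + PowerSeries.C (y ^ q) * T ^ 2 * K)
    (G₁ := PowerSeries.C ((s + 2 : ℕ) : A) * T)
    (Φ := (PowerSeries.C U + PowerSeries.C (y ^ (q + 2 - 1)) * T) ^ (s + 2)) hy
    (by linear_combination U ^ s * hU) hq (by simp [hT]) (by simp [hT]) (by
      have hU' := congrArg (PowerSeries.C (R := A)) hU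
      rw [hK]
      simp only [show s + 2 - 1 = s + 1 by omega,
        show q + 2 - 1 = q + 1 by omega, map_pow, map_natCast] at hU' ⊢
      linear_combination PowerSeries.C y * hU')
  refine ⟨ψ, h0, h1, ?_⟩
  rw [h2]
  have : PowerSeries.coeff 1 (1 + PowerSeries.C (y ^ q) * T ^ 2 * K) = 0 := by
    rw [map_add, mul_assoc, PowerSeries.coeff_C_mul]
    obtain ⟨T', rfl⟩ := PowerSeries.X_dvd_iff.2 hT
    rw [mul_pow, mul_assoc, PowerSeries.coeff_X_pow_mul']
    simp [PowerSeries.coeff_one]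
  rw [this, PowerSeries.coeff_C_mul, show s + 2 - 1 = s + 1 by omega]
  ring

end Roots

/-! ### Coefficients of powers of power series in characteristic `p` -/

section Necessity

variable {A : Type*} [CommRing A]

theorem PowerSeries.exists_C_add_X_pow_mul_pow (y : A) {j : ℕ} (hj : j ≠ 0) (R : PowerSeries A)
    (q : ℕ) : ∃ M : PowerSeries A, (PowerSeries.C y + PowerSeries.X ^ j * R) ^ q =
      PowerSeries.C (y ^ q) + PowerSeries.X ^ j * M ∧
      PowerSeries.constantCoeff M = q * y ^ (q - 1) * PowerSeries.constantCoeff R := by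
  obtain ⟨K, hK⟩ := Polynomial.powAddExpansion (PowerSeries.C y) (PowerSeries.X ^ j * R) q
  refine ⟨PowerSeries.C (q * y ^ (q - 1)) * R + PowerSeries.X ^ j * R ^ 2 * K, ?_, ?_⟩
  · rw [hK]
    simp only [map_mul, map_pow, map_natCast]
    ring
  · simp [hj]

theorem PowerSeries.coeff_C_add_X_pow_mul (y : A) {j : ℕ} (hj : j ≠ 0) (M : PowerSeries A) :
    PowerSeries.coeff j (PowerSeries.C y + PowerSeries.X ^ j * M) =
      PowerSeries.constantCoeff M := by
  rw [map_add, PowerSeries.coeff_C, if_neg hj, zero_add,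
    PowerSeries.coeff_X_pow_mul', if_pos le_rfl,
    Nat.sub_self, PowerSeries.coeff_zero_eq_constantCoeff_apply]

/-- If `ψ ^ q` is constant below order `P`, so is `ψ`: a lowest nonconstant term `b t ^ i` of `ψ`
contributes `q y ^ (q - 1) b t ^ i` to `ψ ^ q`. -/
theorem PowerSeries.exists_eq_C_add_X_pow_mul_of_pow {y : A} {q P : ℕ}
    (hy : ∀ a b, y ^ (q - 1) * a = y ^ (q - 1) * b → a = b) (hq : IsUnit (q : A)) (hP : P ≠ 0)
    {ψ : PowerSeries A} (hψ : PowerSeries.constantCoeff ψ = y)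
    (h : ∀ i, i ≠ 0 → i < P → PowerSeries.coeff i (ψ ^ q) = 0) :
    ∃ R, ψ = PowerSeries.C y + PowerSeries.X ^ P * R := by
  suffices H : ∀ j, j + 1 ≤ P → ∃ R, ψ = PowerSeries.C y + PowerSeries.X ^ (j + 1) * R by
    obtain ⟨j, rfl⟩ := Nat.exists_eq_succ_of_ne_zero hP
    exact H j le_rfl
  intro j
  induction j with
  | zero =>
    intro _
    obtain ⟨R, hR⟩ : PowerSeries.X ∣ ψ - PowerSeries.C y := by
      rw [PowerSeries.X_dvd_iff, map_sub, hψ, PowerSeries.constantCoeff_C, sub_self]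
    exact ⟨R, by linear_combination hR⟩
  | succ j ih =>
    intro hj
    obtain ⟨R, rfl⟩ := ih (by omega)
    obtain ⟨M, hM, hM0⟩ := exists_C_add_X_pow_mul_pow y (Nat.succ_ne_zero j) R q
    have h1 := h (j + 1) (by omega) (by omega)
    rw [hM, coeff_C_add_X_pow_mul _ (by omega), hM0] at h1
    have h2 : PowerSeries.constantCoeff R = 0 := by
      apply hq.mul_left_cancel
      apply hy
      linear_combination h1
    obtain ⟨R', rfl⟩ := PowerSeries.X_dvd_iff.2 h2
    exact ⟨R', by ring⟩

variable {p : ℕ} [Fact p.Prime] [CharP A p]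

instance PowerSeries.charP_of_charP : CharP (PowerSeries A) p :=
  charP_of_injective_ringHom (PowerSeries.C_injective (R := A)) p

theorem PowerSeries.C_add_X_pow_mul_pow_char_pow (x : A) (j a : ℕ) (R : PowerSeries A) :
    (PowerSeries.C x + PowerSeries.X ^ j * R) ^ p ^ a =
      PowerSeries.C (x ^ p ^ a) + PowerSeries.X ^ (j * p ^ a) * R ^ p ^ a := by
  rw [add_pow_char_pow, mul_pow, map_pow, pow_mul]

theorem PowerSeries.coeff_mul_pow_char_pow (φ : PowerSeries A) (a j : ℕ) :
    PowerSeries.coeff (j * p ^ a) (φ ^ p ^ a) = PowerSeries.coeff j φ ^ p ^ a := by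
  have hp : p ^ a ≠ 0 := pow_ne_zero _ (Nat.Prime.ne_zero Fact.out)
  induction j generalizing φ with
  | zero => simp
  | succ j ih =>
    obtain ⟨R, hR⟩ : PowerSeries.X ∣ φ - PowerSeries.C (PowerSeries.constantCoeff φ) := by
      rw [PowerSeries.X_dvd_iff, map_sub, PowerSeries.constantCoeff_C, sub_self]
    have hφ : φ = PowerSeries.C (PowerSeries.constantCoeff φ) + PowerSeries.X ^ 1 * R := by
      linear_combination hR
    have h1 : PowerSeries.coeff (j + 1) φ = PowerSeries.coeff j R := by
      rw [hφ, pow_one, map_add, PowerSeries.coeff_C, if_neg (by omega), zero_add,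
        PowerSeries.coeff_succ_X_mul]
    have h2 : PowerSeries.coeff ((j + 1) * p ^ a) (φ ^ p ^ a) =
        PowerSeries.coeff (j * p ^ a) (R ^ p ^ a) := by
      rw [hφ, C_add_X_pow_mul_pow_char_pow, map_add, PowerSeries.coeff_C, if_neg (by positivity),
        zero_add, PowerSeries.coeff_X_pow_mul', add_mul, if_pos (by omega), Nat.add_sub_cancel]
    rw [h1, h2, ih]

/-- Comparison of the coefficients of `t ^ i` for `i ≤ p ^ a` on a curve `x ^ (p ^ a s) = y ^ q`. -/
theorem PowerSeries.exists_of_coeff_pow_eq {x y f : A} {a s q : ℕ}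
    (hy : ∀ a b, y ^ (q - 1) * a = y ^ (q - 1) * b → a = b) (hq : IsUnit (q : A))
    {φ ψ : PowerSeries A} (hφ : PowerSeries.constantCoeff φ = x)
    (hφ1 : PowerSeries.coeff 1 φ = f) (hψ : PowerSeries.constantCoeff ψ = y)
    (h : ∀ i ≤ p ^ a, PowerSeries.coeff i (φ ^ (p ^ a * s)) = PowerSeries.coeff i (ψ ^ q)) :
    ∃ R, ψ = PowerSeries.C y + PowerSeries.X ^ p ^ a * R ∧
      q * y ^ (q - 1) * PowerSeries.constantCoeff R =
        s * (x ^ p ^ a) ^ (s - 1) * f ^ p ^ a := by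
  have hp : p ^ a ≠ 0 := pow_ne_zero _ (Nat.Prime.ne_zero Fact.out)
  obtain ⟨φ', hφ'⟩ : PowerSeries.X ∣ φ - PowerSeries.C x := by
    rw [PowerSeries.X_dvd_iff, map_sub, hφ, PowerSeries.constantCoeff_C, sub_self]
  have hφ'' : φ = PowerSeries.C x + PowerSeries.X ^ 1 * φ' := by linear_combination hφ'
  have hφ0 : PowerSeries.constantCoeff φ' = f := by
    rw [← hφ1, hφ'', coeff_C_add_X_pow_mul _ one_ne_zero]
  obtain ⟨M, hM, hM0⟩ := exists_C_add_X_pow_mul_pow (x ^ p ^ a) hp (φ' ^ p ^ a) s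
  have hφn : φ ^ (p ^ a * s) =
      PowerSeries.C ((x ^ p ^ a) ^ s) + PowerSeries.X ^ p ^ a * M := by
    rw [pow_mul, hφ'', C_add_X_pow_mul_pow_char_pow, one_mul, hM]
  obtain ⟨R, hR⟩ := exists_eq_C_add_X_pow_mul_of_pow (P := p ^ a) hy hq hp hψ (by
    intro i hi hip
    rw [← h i hip.le, hφn, map_add, PowerSeries.coeff_C, if_neg hi,
      PowerSeries.coeff_X_pow_mul', if_neg hip.not_ge, add_zero])
  refine ⟨R, hR, ?_⟩
  obtain ⟨M', hM', hM0'⟩ := exists_C_add_X_pow_mul_pow y hp R q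
  have := h _ le_rfl
  rw [hφn, hR, hM', coeff_C_add_X_pow_mul _ hp, coeff_C_add_X_pow_mul _ hp, hM0, hM0', map_pow,
    hφ0] at this
  exact this.symm

/-- Comparison of the coefficients of `t ^ (p ^ (a + b))` on a curve
`x ^ (p ^ a) = y ^ (1 + p ^ b r)`. -/
theorem PowerSeries.coeff_pow_eq_of_coeff_pow_eq {y : A} {a b r : ℕ} {φ R : PowerSeries A}
    (h : PowerSeries.coeff (p ^ b * p ^ a) (φ ^ p ^ a) = PowerSeries.coeff (p ^ b * p ^ a)
      ((PowerSeries.C y + PowerSeries.X ^ p ^ a * R) ^ (1 + p ^ b * r))) :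
    ∃ c, PowerSeries.coeff (p ^ b) φ ^ p ^ a =
      y ^ (p ^ b * r) * c +
        r * y ^ (1 + p ^ b * (r - 1)) * PowerSeries.constantCoeff R ^ p ^ b := by
  have hp : p ^ a ≠ 0 := pow_ne_zero _ (Nat.Prime.ne_zero Fact.out)
  have hp' : p ^ a * p ^ b ≠ 0 := mul_ne_zero hp (pow_ne_zero _ (Nat.Prime.ne_zero Fact.out))
  obtain ⟨M, hM, hM0⟩ := exists_C_add_X_pow_mul_pow (y ^ p ^ b) hp' (R ^ p ^ b) r
  refine ⟨PowerSeries.coeff (p ^ a * p ^ b) (PowerSeries.C y + PowerSeries.X ^ p ^ a * R), ?_⟩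
  rw [coeff_mul_pow_char_pow, pow_add, pow_one, pow_mul _ (p ^ b), C_add_X_pow_mul_pow_char_pow, hM,
    mul_add, map_add, mul_comm _ (PowerSeries.C _), PowerSeries.coeff_C_mul,
    mul_left_comm _ (_ ^ _),
    mul_comm (p ^ b), PowerSeries.coeff_X_pow_mul', if_pos le_rfl, Nat.sub_self,
    PowerSeries.coeff_zero_eq_constantCoeff_apply, map_mul, hM0] at h
  have hc : PowerSeries.constantCoeff (PowerSeries.C y + PowerSeries.X ^ p ^ a * R) = y := by
    simp [zero_pow hp]
  rw [h, hc, map_pow, mul_comm (p ^ b)]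
  ring

end Necessity

/-! ### Integrable derivations -/

theorem pow_eq_pow_pow {M : Type*} [Monoid M] (z : M) {n c d : ℕ} (h : n = c * d) :
    z ^ n = (z ^ c) ^ d := by
  rw [h, pow_mul]

section Integrals

variable {k : Type*} [CommRing k] {n q : ℕ}
  {δ : Derivation k (CurveRing k n q) (CurveRing k n q)}

/-- The Euler derivation integrates to `x ↦ (1 + t) ^ q x`, `y ↦ (1 + t) ^ n y`. -/
theorem mem_IDer_of_euler (hx : δ (curveX k n q) = q * curveX k n q)
    (hy : δ (curveY k n q) = n * curveY k n q) : δ ∈ IDer k (CurveRing k n q) ⊤ := by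
  refine (mem_IDer_curve_iff le_top δ).2
    ⟨PowerSeries.C (curveX k n q) * (1 + PowerSeries.X) ^ q,
      PowerSeries.C (curveY k n q) * (1 + PowerSeries.X) ^ n, ?_, ?_, ?_, ?_, fun i _ => ?_⟩
  · simp
  · simp
  · rw [PowerSeries.coeff_C_mul, PowerSeries.coeff_one_pow, hx]
    simp [PowerSeries.coeff_one]
    ring
  · rw [PowerSeries.coeff_C_mul, PowerSeries.coeff_one_pow, hy]
    simp [PowerSeries.coeff_one]
    ring
  · rw [mul_pow, mul_pow, ← pow_mul, ← pow_mul, mul_comm q n, ← map_pow, ← map_pow, curveX_pow]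

/-- The Hamiltonian derivation of `x ^ n - y ^ q` is integrable. If `n = 1` or `q = 1` the
curve is a line; otherwise `φ = x + q y ^ (q - 1) t`, and `ψ` is a root of `φ ^ n` over `A`. -/
theorem mem_IDer_of_hamiltonian (hn : n ≠ 0 ∨ q = 1) (hq : IsUnit (q : CurveRing k n q))
    (hq0 : q ≠ 0)
    (hx : δ (curveX k n q) = q * curveY k n q ^ (q - 1))
    (hy : δ (curveY k n q) = n * curveX k n q ^ (n - 1)) : δ ∈ IDer k (CurveRing k n q) ⊤ := by
  rw [mem_IDer_curve_iff le_top]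
  by_cases hq1 : q = 1
  · subst hq1
    refine ⟨PowerSeries.C (curveX k n 1) + PowerSeries.X,
      (PowerSeries.C (curveX k n 1) + PowerSeries.X) ^ n, ?_, ?_, ?_, ?_, fun i _ => ?_⟩
    · simp
    · simp [curveX_pow]
    · rw [hx]
      simp
    · rw [PowerSeries.coeff_one_pow, hy]
      simp
    · rw [pow_one]
  by_cases hn1 : n = 1
  · subst hn1
    refine ⟨(PowerSeries.C (curveY k 1 q) + PowerSeries.X) ^ q,
      PowerSeries.C (curveY k 1 q) + PowerSeries.X, ?_, ?_, ?_, ?_, fun i _ => ?_⟩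
    · simp [← curveX_pow]
    · simp
    · rw [PowerSeries.coeff_one_pow, hx]
      simp
    · rw [hy]
      simp
    · rw [pow_one]
  obtain ⟨ψ, h0, hψ, h1⟩ := PowerSeries.exists_pow_eq_add_pow (y := curveY k n q)
    (U := curveX k n q) (fun _ _ => curveY_mul_left_cancel hq0) hq (by omega) (s := n)
    (by omega) (curveX_pow k n q)
    (T := PowerSeries.C (q : CurveRing k n q) * PowerSeries.X) (by simp)
  refine ⟨PowerSeries.C (curveX k n q) + PowerSeries.C (curveY k n q ^ (q - 1)) *
    (PowerSeries.C (q : CurveRing k n q) * PowerSeries.X), ψ, by simp, h0, ?_, ?_, fun i _ => ?_⟩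
  · rw [hx, map_add, PowerSeries.coeff_C_mul, PowerSeries.coeff_C_mul, PowerSeries.coeff_one_X,
      PowerSeries.coeff_C, if_neg one_ne_zero]
    ring
  · apply hq.mul_left_cancel
    rw [h1, hy, PowerSeries.coeff_C_mul, PowerSeries.coeff_one_X]
    ring
  · rw [hψ]

end Integrals

section CharP

variable {k : Type*} [CommRing k] {p : ℕ} [CharP k p] {n q a s : ℕ}

theorem charP_curveRing (hn : n ≠ 0) (hq : q ≠ 0) : CharP (CurveRing k n q) p :=
  charP_of_injective_algebraMap (algebraMap_curveRing_injective hn hq) p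

variable [Fact p.Prime]

variable (k) in
theorem isUnit_natCast_curveRing {j : ℕ} (hj : ¬ p ∣ j) : IsUnit (j : CurveRing k n q) := by
  have h : IsUnit (j : k) := (CharP.isUnit_natCast_iff Fact.out).2 hj
  simpa using h.map (algebraMap k (CurveRing k n q))

variable {δ : Derivation k (CurveRing k n q) (CurveRing k n q)}

/-- `∂x` is integrable below length `p ^ a`, through `φ = x + t` and `ψ = y`. -/
theorem mem_IDer_of_lt (hns : n = p ^ a * s) (hn : n ≠ 0) (hq : q ≠ 0) (hx : δ (curveX k n q) = 1)
    (hy : δ (curveY k n q) = 0) {i : ℕ∞} (hi : 1 ≤ i) (hip : i < (p ^ a : ℕ)) :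
    δ ∈ IDer k (CurveRing k n q) i := by
  have := charP_curveRing (k := k) (p := p) hn hq
  have hp : p ^ a ≠ 0 := pow_ne_zero _ (Nat.Prime.ne_zero Fact.out)
  refine (mem_IDer_curve_iff hi δ).2 ⟨PowerSeries.C (curveX k n q) + PowerSeries.X ^ 1 * 1,
    PowerSeries.C (curveY k n q), by simp, by simp, ?_, ?_, fun j hj => ?_⟩
  · rw [hx, PowerSeries.coeff_C_add_X_pow_mul _ one_ne_zero, map_one]
  · rw [hy, PowerSeries.coeff_C, if_neg one_ne_zero]
  · have hjp : j < p ^ a := by exact_mod_cast hj.trans_lt hip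
    obtain ⟨M, hM, -⟩ := PowerSeries.exists_C_add_X_pow_mul_pow (curveX k n q ^ p ^ a) hp 1 s
    have h1 : (PowerSeries.C (curveX k n q) + PowerSeries.X ^ 1 * 1) ^ n =
        PowerSeries.C (curveX k n q ^ n) + PowerSeries.X ^ p ^ a * M := by
      conv_lhs => rw [pow_eq_pow_pow _ hns, PowerSeries.C_add_X_pow_mul_pow_char_pow, one_mul, one_pow, hM]
      rw [← pow_mul, ← hns]
    rw [h1, map_add, PowerSeries.coeff_X_pow_mul', if_neg hjp.not_ge, add_zero, curveX_pow, map_pow]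

/-- `y ^ j ∂x` is integrable for `j p ^ a ≥ q`: with `φ = x + y ^ j t`, the series `φ ^ n`
is `y ^ q` times a series over `A` with constant term `1`. -/
theorem mem_IDer_of_le (hns : n = p ^ a * s) (hn : n ≠ 0) (ha : a ≠ 0)
    (hq0 : q ≠ 0) (hq : ¬ p ∣ q) {j : ℕ}
    (hj : q ≤ j * p ^ a) (hx : δ (curveX k n q) = curveY k n q ^ j)
    (hy : δ (curveY k n q) = 0) : δ ∈ IDer k (CurveRing k n q) ⊤ := by
  have := charP_curveRing (k := k) (p := p) hn hq0
  have hp1 : 1 < p ^ a := Nat.one_lt_pow ha (Nat.Prime.one_lt Fact.out)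
  have hu := isUnit_natCast_curveRing k (n := n) (q := q) hq
  obtain ⟨e, he⟩ := Nat.exists_eq_add_of_le hj
  obtain ⟨K, hK⟩ := sub_dvd_pow_sub_pow (PowerSeries.C (curveX k n q ^ p ^ a) +
    PowerSeries.X ^ p ^ a * PowerSeries.C (curveY k n q ^ j) ^ p ^ a)
    (PowerSeries.C (curveX k n q ^ p ^ a)) s
  have hG1 : PowerSeries.coeff 1 (1 + PowerSeries.X ^ p ^ a *
      (PowerSeries.C (curveY k n q ^ e) * K)) = 0 := by
    rw [map_add, PowerSeries.coeff_X_pow_mul', if_neg (by omega), PowerSeries.coeff_one,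
      if_neg one_ne_zero, add_zero]
  obtain ⟨F, hF0, hF⟩ := PowerSeries.exists_pow_eq_of_isUnit hu (G := 1 + PowerSeries.X ^ p ^ a *
    (PowerSeries.C (curveY k n q ^ e) * K)) (by simp [zero_pow (show p ^ a ≠ 0 by omega)])
  refine (mem_IDer_curve_iff le_top δ).2
    ⟨PowerSeries.C (curveX k n q) + PowerSeries.X ^ 1 * PowerSeries.C (curveY k n q ^ j),
    PowerSeries.C (curveY k n q) * F, by simp, by simp [hF0], ?_, ?_, fun i _ => congrArg _ ?_⟩
  · rw [hx, PowerSeries.coeff_C_add_X_pow_mul _ one_ne_zero, PowerSeries.constantCoeff_C]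
  · apply hu.mul_left_cancel
    rw [← hF, PowerSeries.coeff_one_pow, hF0, one_pow, mul_one] at hG1
    rw [hy, PowerSeries.coeff_C_mul, mul_left_comm, hG1, mul_zero, mul_zero]
  · have hX := congrArg (PowerSeries.C (R := CurveRing k n q)) (curveX_pow k n q)
    conv_lhs => rw [pow_eq_pow_pow _ hns, PowerSeries.C_add_X_pow_mul_pow_char_pow, one_mul]
    rw [pow_eq_pow_pow _ hns, map_pow] at hX
    rw [mul_pow, hF]
    have h2 : (PowerSeries.C (curveY k n q ^ j) : PowerSeries (CurveRing k n q)) ^ p ^ a =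
        PowerSeries.C (curveY k n q) ^ q * PowerSeries.C (curveY k n q ^ e) := by
      rw [← map_pow, ← map_pow, ← map_mul, ← pow_mul, ← pow_add, he]
    rw [h2] at hK ⊢
    rw [map_pow _ _ q] at hX
    linear_combination hK + hX

/-- The borderline case `j p ^ a = q - 1` for `s ≥ 2`, through the root of
`(x + y ^ j t) ^ n` given by `PowerSeries.exists_pow_eq_add_pow`. -/
theorem mem_IDer_of_two_le (hns : n = p ^ a * s) (hn : n ≠ 0) (ha : a ≠ 0)
    (hs : 2 ≤ s) (hq2 : 2 ≤ q) (hq : ¬ p ∣ q) {j : ℕ}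
    (hj : j * p ^ a + 1 = q) (hx : δ (curveX k n q) = curveY k n q ^ j)
    (hy : δ (curveY k n q) = 0) : δ ∈ IDer k (CurveRing k n q) ⊤ := by
  have := charP_curveRing (k := k) (p := p) hn (show q ≠ 0 by omega)
  have hp1 : 1 < p ^ a := Nat.one_lt_pow ha (Nat.Prime.one_lt Fact.out)
  have hu := isUnit_natCast_curveRing k (n := n) (q := q) hq
  obtain ⟨ψ, h0, hψ, h1⟩ := PowerSeries.exists_pow_eq_add_pow (y := curveY k n q)
    (U := curveX k n q ^ p ^ a) (fun _ _ => curveY_mul_left_cancel (by omega)) hu hq2 hs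
    (by rw [← pow_mul, ← hns, curveX_pow])
    (T := PowerSeries.X ^ p ^ a) (by simp [zero_pow (show p ^ a ≠ 0 by omega)])
  refine (mem_IDer_curve_iff le_top δ).2
    ⟨PowerSeries.C (curveX k n q) + PowerSeries.X ^ 1 * PowerSeries.C (curveY k n q ^ j),
    ψ, by simp, h0, ?_, ?_, fun i _ => congrArg _ ?_⟩
  · rw [hx, PowerSeries.coeff_C_add_X_pow_mul _ one_ne_zero, PowerSeries.constantCoeff_C]
  · apply hu.mul_left_cancel
    rw [h1, hy, PowerSeries.coeff_X_pow, if_neg (by omega), mul_zero, mul_zero]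
  · conv_lhs => rw [pow_eq_pow_pow _ hns, PowerSeries.C_add_X_pow_mul_pow_char_pow, one_mul, ← map_pow,
      ← pow_mul]
    rw [hψ, ← hj, Nat.add_sub_cancel, mul_comm (PowerSeries.X ^ _)]

/-- The borderline case `j p ^ a = q - 1` for `s = 1`: the pair `φ = x + y ^ j t`,
`ψ = y + t ^ (p ^ a)` solves the equation of the curve below order `p ^ (a + b)`. -/
theorem mem_IDer_of_exceptional {b r : ℕ} (hn : n = p ^ a) (ha : a ≠ 0)
    (hq : q = 1 + p ^ b * r) {j : ℕ}
    (hj : j * p ^ a + 1 = q) (hx : δ (curveX k n q) = curveY k n q ^ j)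
    (hy : δ (curveY k n q) = 0) {i : ℕ∞} (hi : 1 ≤ i) (hip : i < (p ^ (a + b) : ℕ)) :
    δ ∈ IDer k (CurveRing k n q) i := by
  have hp1 : 1 < p ^ a := Nat.one_lt_pow ha (Nat.Prime.one_lt Fact.out)
  have hpab : p ^ (a + b) ≠ 0 := pow_ne_zero _ (Nat.Prime.ne_zero Fact.out)
  have := charP_curveRing (k := k) (p := p) (n := n) (q := q) (by omega) (by omega)
  refine (mem_IDer_curve_iff hi δ).2
    ⟨PowerSeries.C (curveX k n q) + PowerSeries.X ^ 1 * PowerSeries.C (curveY k n q ^ j),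
    PowerSeries.C (curveY k n q) + PowerSeries.X ^ p ^ a * 1, by simp,
    by simp [zero_pow (show p ^ a ≠ 0 by omega)], ?_, ?_, fun l hl => ?_⟩
  · rw [hx, PowerSeries.coeff_C_add_X_pow_mul _ one_ne_zero, PowerSeries.constantCoeff_C]
  · rw [hy, map_add, PowerSeries.coeff_C, if_neg one_ne_zero, PowerSeries.coeff_X_pow_mul',
      if_neg (by omega), zero_add]
  · have hlp : l < p ^ (a + b) := by exact_mod_cast hl.trans_lt hip
    obtain ⟨M, hM, -⟩ := PowerSeries.exists_C_add_X_pow_mul_pow (curveY k n q ^ p ^ b) hpab 1 r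
    have h1 : (PowerSeries.C (curveX k n q) +
          PowerSeries.X ^ 1 * PowerSeries.C (curveY k n q ^ j)) ^ n =
        PowerSeries.C (curveY k n q ^ q) +
          PowerSeries.X ^ p ^ a * PowerSeries.C (curveY k n q ^ (j * p ^ a)) := by
      rw [← curveX_pow, congrArg (_ ^ ·) hn, PowerSeries.C_add_X_pow_mul_pow_char_pow, one_mul,
        congrArg (curveX k n q ^ ·) hn, ← map_pow, ← pow_mul]
    have h2 : (PowerSeries.C (curveY k n q) + PowerSeries.X ^ p ^ a * 1) ^ q =
        PowerSeries.C (curveY k n q ^ q) +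
          PowerSeries.X ^ p ^ a * PowerSeries.C (curveY k n q ^ (j * p ^ a)) +
          PowerSeries.X ^ p ^ (a + b) *
            (M * (PowerSeries.C (curveY k n q) + PowerSeries.X ^ p ^ a)) := by
      have hjr : j * p ^ a = p ^ b * r := by omega
      conv_lhs => rw [congrArg (_ ^ ·) hq, pow_add, pow_one, pow_mul,
        PowerSeries.C_add_X_pow_mul_pow_char_pow, ← pow_add, one_pow, hM]
      have h3 : curveY k n q ^ q = curveY k n q * (curveY k n q ^ p ^ b) ^ r := by
        rw [← pow_mul, ← pow_succ', ← hjr, hj]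
      rw [h3, hjr, pow_mul _ _ r, map_mul]
      ring
    rw [h1, h2, map_add _ _ (PowerSeries.X ^ p ^ (a + b) * _),
      PowerSeries.coeff_X_pow_mul', if_neg hlp.not_ge, add_zero]

end CharP

/-! ### Obstructions to integrability -/

section Obstructions

variable {k : Type*} [CommRing k] {p : ℕ} [Fact p.Prime] [CharP k p]

theorem Polynomial.coeff_pow_char_pow_of_not_dvd (u : Polynomial k) {a l : ℕ} (h : ¬ p ^ a ∣ l) :
    (u ^ p ^ a).coeff l = 0 := by
  rw [← Polynomial.map_iterateFrobenius_expand p u a, Polynomial.coeff_map,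
    Polynomial.coeff_expand (pow_pos (Nat.Prime.pos Fact.out) a), if_neg h, map_zero]

theorem Polynomial.coeff_mul_pow_char_pow (u : Polynomial k) (a j : ℕ) :
    (u ^ p ^ a).coeff (j * p ^ a) = u.coeff j ^ p ^ a := by
  rw [← Polynomial.map_iterateFrobenius_expand p u a, Polynomial.coeff_map,
    Polynomial.coeff_expand_mul (pow_pos (Nat.Prime.pos Fact.out) a), iterateFrobenius_def]

variable {n q a s : ℕ} {δ : Derivation k (CurveRing k n q) (CurveRing k n q)}

theorem aeval_add_pow_char_pow (hn : n ≠ 0) (hq : q ≠ 0) (a : ℕ) (u : Polynomial k)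
    (b : CurveRing k n q) :
    (Polynomial.aeval (curveY k n q) u + curveX k n q * b) ^ p ^ a =
      Polynomial.aeval (curveY k n q) (u ^ p ^ a) + curveX k n q ^ p ^ a * b ^ p ^ a := by
  have := charP_curveRing (k := k) (p := p) hn hq
  rw [add_pow_char_pow, map_pow, mul_pow]

/-- The obstruction to lifting `f ∂x` to length `p ^ a`: the coefficient of `t ^ (p ^ a)` in the
equation of the curve says that `y ^ (q - 1)` divides `x ^ (n - p ^ a) f ^ (p ^ a)`. As `k` is
reduced this bounds the order in `y` of `f` modulo `x` from below. -/
theorem exists_eq_of_mem_IDer [IsReduced k] (hns : n = p ^ a * s) (hs : ¬ p ∣ s) (hq : ¬ p ∣ q)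
    (hδ : δ ∈ IDer k (CurveRing k n q) (p ^ a : ℕ)) {j : ℕ}
    (hj : ∀ l < j, l * p ^ a + 1 < q) :
    ∃ b c, δ (curveX k n q) = curveX k n q * b + curveY k n q ^ j * c := by
  have hp : p ^ a ≠ 0 := pow_ne_zero _ (Nat.Prime.ne_zero Fact.out)
  have hs0 : s ≠ 0 := by rintro rfl; simp at hs
  have hq0 : q ≠ 0 := by rintro rfl; simp at hq
  have hn : n ≠ 0 := by rw [hns]; exact mul_ne_zero hp hs0
  have := charP_curveRing (k := k) (p := p) hn hq0
  have hu := isUnit_natCast_curveRing k (n := n) (q := q) hs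
  obtain ⟨φ, ψ, hφ, hψ, hφ1, -, h⟩ := (mem_IDer_curve_iff
    (by exact_mod_cast Nat.one_le_iff_ne_zero.2 hp) δ).1 hδ
  obtain ⟨R, -, hR⟩ := PowerSeries.exists_of_coeff_pow_eq (p := p) (a := a) (s := s) (q := q)
    (fun _ _ => curveY_pow_cancel hq0 (q - 1))
    (isUnit_natCast_curveRing k hq) hφ hφ1 hψ (by
      intro i hi
      rw [← h i (by exact_mod_cast hi), pow_mul, ← pow_eq_pow_pow _ hns])
  obtain ⟨u, b, hub⟩ := exists_eq_aeval_curveY_add (δ (curveX k n q))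
  rw [hub, aeval_add_pow_char_pow hn hq0] at hR
  obtain ⟨s', hs'⟩ := hu.exists_right_inv
  have hx : (curveX k n q ^ p ^ a) ^ (s - 1) * curveX k n q ^ p ^ a =
      curveY k n q ^ (q - 1) * curveY k n q := by
    rw [← pow_succ, ← pow_succ, Nat.sub_add_cancel (by omega), Nat.sub_add_cancel (by omega),
      ← pow_eq_pow_pow _ hns, curveX_pow]
  have key : curveX k n q ^ (p ^ a * (s - 1)) * Polynomial.aeval (curveY k n q) (u ^ p ^ a) =
      curveY k n q ^ (q - 1) * (s' * q * PowerSeries.constantCoeff R -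
        curveY k n q * b ^ p ^ a) := by
    rw [pow_mul]
    linear_combination (-s') * hR - b ^ p ^ a * hx + (-(curveX k n q ^ p ^ a) ^ (s - 1) *
      (Polynomial.aeval (curveY k n q) (u ^ p ^ a) + curveX k n q ^ p ^ a * b ^ p ^ a)) * hs'
  have hlt : p ^ a * (s - 1) < n := by
    rw [hns]
    exact Nat.mul_lt_mul_of_pos_left (by omega) (by omega)
  have hX : Polynomial.X ^ j ∣ u := by
    rw [Polynomial.X_pow_dvd_iff]
    intro l hl
    have h0 := coeff_eq_zero_of_curveX_pow_mul_eq hlt (by omega) key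
      (show l * p ^ a < q - 1 by have := hj l hl; omega)
    rw [Polynomial.coeff_mul_pow_char_pow] at h0
    exact eq_zero_of_pow_eq_zero h0
  obtain ⟨v, rfl⟩ := hX
  refine ⟨b, Polynomial.aeval (curveY k n q) v, ?_⟩
  rw [hub, map_mul, map_pow, Polynomial.aeval_X, add_comm]

/-- The second obstruction, on the curve `x ^ (p ^ a) = y ^ (1 + p ^ b r)`: if the leading
coefficient of `f` modulo `x` at `y ^ j`, `j p ^ a = q - 1`, is `c`, then the coefficient of
`t ^ (p ^ (a + b))` in the equation of the curve contains `r c ^ (p ^ (a + b)) y ^ (q - p ^ b)`,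
which cannot be cancelled by a `p ^ a`-th power. -/
theorem exists_eq_of_mem_IDer_exceptional [IsReduced k] {b r j : ℕ} (hn : n = p ^ a) (ha : a ≠ 0)
    (hb : b ≠ 0) (hr : ¬ p ∣ r) (hq : q = 1 + p ^ b * r) (hj : j * p ^ a + 1 = q)
    (hδ : δ ∈ IDer k (CurveRing k n q) (p ^ (a + b) : ℕ)) :
    ∃ b c, δ (curveX k n q) = curveX k n q * b + curveY k n q ^ (j + 1) * c := by
  have hp : p ^ a ≠ 0 := pow_ne_zero _ (Nat.Prime.ne_zero Fact.out)
  have hpb : p ^ b ≠ 0 := pow_ne_zero _ (Nat.Prime.ne_zero Fact.out)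
  have hpb1 : 1 < p ^ b := Nat.one_lt_pow hb (Nat.Prime.one_lt Fact.out)
  have hpab : p ^ (a + b) ≠ 0 := pow_ne_zero _ (Nat.Prime.ne_zero Fact.out)
  have hr0 : r ≠ 0 := by rintro rfl; simp at hr
  have hn0 : n ≠ 0 := by omega
  have hq0 : q ≠ 0 := by omega
  have hns : n = p ^ a * 1 := by omega
  have hp1 : ¬ p ∣ 1 := (Nat.Prime.one_lt (Fact.out : p.Prime)).ne' ∘ Nat.dvd_one.1
  have hpq : ¬ p ∣ q := by
    rw [hq, ← Nat.dvd_add_iff_left (dvd_mul_of_dvd_left (dvd_pow_self p hb) r)]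
    exact hp1
  have := charP_curveRing (k := k) (p := p) hn0 hq0
  have hle : p ^ a ≤ p ^ (a + b) :=
    Nat.pow_le_pow_right (Nat.Prime.pos Fact.out) (Nat.le_add_right a b)
  have hq1 : ((q : ℕ) : CurveRing k n q) = 1 := by
    have : ((1 + p ^ b * r : ℕ) : CurveRing k n q) = 1 := by
      rw [Nat.cast_add, Nat.cast_mul, Nat.cast_pow, CharP.cast_eq_zero (CurveRing k n q) p, zero_pow hb, zero_mul,
        add_zero, Nat.cast_one]
    rw [← this]
    exact congrArg _ hq
  obtain ⟨b₀, w, hw⟩ := exists_eq_of_mem_IDer hns hp1 hpq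
    (IDer_anti (by exact_mod_cast Nat.one_le_iff_ne_zero.2 hp) (by exact_mod_cast hle) hδ)
    (j := j) (fun l hl => by
      rw [← hj]
      have := Nat.mul_lt_mul_of_pos_right hl (Nat.pos_of_ne_zero hp)
      omega)
  obtain ⟨φ, ψ, hφ, hψ, hφ1, -, h⟩ := (mem_IDer_curve_iff
    (by exact_mod_cast Nat.one_le_iff_ne_zero.2 hpab) δ).1 hδ
  obtain ⟨R, rfl, hR⟩ := PowerSeries.exists_of_coeff_pow_eq (p := p) (a := a) (s := 1) (q := q)
    (fun _ _ => curveY_pow_cancel hq0 (q - 1))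
    (isUnit_natCast_curveRing k hpq) hφ hφ1 hψ (by
      intro i hi
      rw [← h i (by exact_mod_cast hi.trans hle), pow_mul, ← pow_eq_pow_pow _ hns])
  -- expand the coefficient `w` of `y ^ j` as `c + y w'` modulo `x`
  obtain ⟨v, b₁, rfl⟩ := exists_eq_aeval_curveY_add w
  rw [← Polynomial.divX_mul_X_add v] at hw
  generalize Polynomial.divX v = v' at hw
  generalize v.coeff 0 = c at hw
  have hw' : δ (curveX k n q) = curveX k n q * (b₀ + curveY k n q ^ j * b₁) +
      curveY k n q ^ j * (algebraMap k _ c + curveY k n q * Polynomial.aeval (curveY k n q) v') := by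
    rw [hw, map_add, map_mul, Polynomial.aeval_X, Polynomial.aeval_C]
    ring
  generalize b₀ + curveY k n q ^ j * b₁ = b₂ at hw'
  generalize Polynomial.aeval (curveY k n q) v' = w' at hw'
  obtain ⟨e, he⟩ : ∃ e, PowerSeries.constantCoeff R =
      algebraMap k _ c ^ p ^ a + curveY k n q * e := by
    refine ⟨curveY k n q ^ (p ^ a - 1) * w' ^ p ^ a + b₂ ^ p ^ a, ?_⟩
    apply curveY_pow_cancel hq0 (q - 1)
    have hy : curveY k n q ^ p ^ a = curveY k n q * curveY k n q ^ (p ^ a - 1) := by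
      rw [← pow_succ', Nat.sub_add_cancel (by omega)]
    have hyq : curveX k n q ^ p ^ a = curveY k n q ^ (q - 1) * curveY k n q := by
      rw [← pow_succ, Nat.sub_add_cancel (by omega), ← curveX_pow, congrArg (curveX k n q ^ ·) hn]
    have hyj : (curveY k n q ^ j) ^ p ^ a = curveY k n q ^ (q - 1) := by
      rw [← pow_mul, ← hj, Nat.add_sub_cancel]
    rw [hq1, hw', add_pow_char_pow, mul_pow, mul_pow, add_pow_char_pow, mul_pow, hyj, hyq, hy] at hR
    linear_combination hR
  obtain ⟨d, hd⟩ := PowerSeries.coeff_pow_eq_of_coeff_pow_eq (p := p) (a := a) (b := b) (r := r)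
    (y := curveY k n q) (φ := φ) (R := R) (by
      have := h (p ^ (a + b)) le_rfl
      rw [congrArg (_ ^ ·) hn, congrArg (_ ^ ·) hq] at this
      rw [← pow_add, add_comm b a]
      exact this)
  obtain ⟨g, g', hg⟩ := exists_eq_aeval_curveY_add (PowerSeries.coeff (p ^ b) φ)
  rw [hg, aeval_add_pow_char_pow hn0 hq0, he, add_pow_char_pow, mul_pow, ← pow_mul, ← pow_add] at hd
  have hyq : curveX k n q ^ p ^ a = curveY k n q ^ (p ^ b * r) * curveY k n q := by
    rw [← pow_succ, add_comm, ← congrArg (curveY k n q ^ ·) hq, ← curveX_pow,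
      congrArg (curveX k n q ^ ·) hn]
  have hyb : curveY k n q ^ (1 + p ^ b * (r - 1)) * curveY k n q ^ p ^ b =
      curveY k n q ^ (p ^ b * r) * curveY k n q := by
    obtain ⟨r, rfl⟩ := Nat.exists_eq_succ_of_ne_zero hr0
    rw [Nat.succ_eq_add_one, Nat.add_sub_cancel]
    ring
  have key : curveX k n q ^ 0 * Polynomial.aeval (curveY k n q) (g ^ p ^ a -
      Polynomial.C ((r : k) * c ^ p ^ (a + b)) * Polynomial.X ^ (1 + p ^ b * (r - 1))) =
      curveY k n q ^ (p ^ b * r) * (d + curveY k n q * (r * e ^ p ^ b - g' ^ p ^ a)) := by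
    rw [map_sub, map_mul, map_pow (Polynomial.aeval (curveY k n q)) Polynomial.X, Polynomial.aeval_X,
      Polynomial.aeval_C, map_mul, map_pow (algebraMap k _), map_natCast]
    linear_combination hd - g' ^ p ^ a * hyq + r * e ^ p ^ b * hyb
  have hlt : 1 + p ^ b * (r - 1) < p ^ b * r := by
    obtain ⟨r, rfl⟩ := Nat.exists_eq_succ_of_ne_zero hr0
    rw [Nat.succ_eq_add_one, Nat.add_sub_cancel, mul_add]
    omega
  have h0 := coeff_eq_zero_of_curveX_pow_mul_eq (Nat.pos_of_ne_zero hn0) (by omega) key hlt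
  have hnd : ¬ p ^ a ∣ 1 + p ^ b * (r - 1) := by
    intro hdvd
    refine hp1 ((Nat.dvd_add_iff_left (dvd_mul_of_dvd_left (dvd_pow_self p hb) (r - 1))).2
      ((dvd_pow_self p ha).trans hdvd))
  rw [Polynomial.coeff_sub, Polynomial.coeff_pow_char_pow_of_not_dvd g hnd,
    Polynomial.coeff_C_mul_X_pow, if_pos rfl, zero_sub, neg_eq_zero] at h0
  have hc : c = 0 := by
    refine eq_zero_of_pow_eq_zero (n := p ^ (a + b))
      (((CharP.isUnit_natCast_iff (R := k) (p := p) Fact.out).2 hr).mul_left_cancel ?_)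
    rw [h0, mul_zero]
  refine ⟨b₂, w', ?_⟩
  rw [hw', hc, map_zero]
  ring

end Obstructions

/-! ### The module of derivations of the curve -/

theorem mem_derLog_span_singleton {k R : Type*} [CommRing k] [CommRing R] [Algebra k R] {h : R}
    {δ : Derivation k R R} (hδ : h ∣ δ h) : δ ∈ derLog k (Ideal.span {h}) := by
  intro f hf
  obtain ⟨g, rfl⟩ := Ideal.mem_span_singleton.1 hf
  rw [δ.leibniz, smul_eq_mul, smul_eq_mul, Ideal.mem_span_singleton]
  exact dvd_add (dvd_mul_right _ _) (dvd_mul_of_dvd_right hδ _)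

theorem derBar_smul {k R : Type*} [CommRing k] [CommRing R] [Algebra k R] {I : Ideal R}
    (δ : derLog k I) (F : R) : derBar (F • δ) = Ideal.Quotient.mk I F • derBar δ := by
  ext a
  obtain ⟨a, rfl⟩ := Ideal.Quotient.mk_surjective a
  rw [Derivation.smul_apply, derBar_mk, derBar_mk]
  exact map_mul _ _ _

section Derivations

variable {k : Type*} [CommRing k] {n q : ℕ}

theorem derivation_curve_relation (δ : Derivation k (CurveRing k n q) (CurveRing k n q)) :
    (n : CurveRing k n q) * curveX k n q ^ (n - 1) * δ (curveX k n q) =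
      q * curveY k n q ^ (q - 1) * δ (curveY k n q) := by
  have h := congrArg δ (curveX_pow k n q)
  rw [δ.leibniz_pow, δ.leibniz_pow] at h
  simpa [mul_assoc] using h

/-- When `n` and `q` are invertible, the derivations of the curve are combinations of the Euler and
the Hamiltonian derivation: subtracting a multiple of the former makes a lift to `k[x, y]` kill
`x ^ n - y ^ q`, and then it is a multiple of the latter. -/
theorem exists_euler_hamiltonian (hn0 : n ≠ 0) (hq0 : q ≠ 0)
    (hn : IsUnit (n : k)) (hq : IsUnit (q : k))
    (δ : Derivation k (CurveRing k n q) (CurveRing k n q)) : ∃ a b : CurveRing k n q,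
      δ (curveX k n q) = a * (q * curveX k n q) + b * (q * curveY k n q ^ (q - 1)) ∧
      δ (curveY k n q) = a * (n * curveY k n q) + b * (n * curveX k n q ^ (n - 1)) := by
  obtain ⟨n', hn'⟩ := hn.exists_right_inv
  obtain ⟨q', hq'⟩ := hq.exists_right_inv
  obtain ⟨F, hF⟩ := Ideal.Quotient.mk_surjective (δ (curveX k n q))
  obtain ⟨G, hG⟩ := Ideal.Quotient.mk_surjective (δ (curveY k n q))
  have h := derivation_curve_relation δ
  rw [← hF, ← hG, curveX, curveY, ← map_natCast (Ideal.Quotient.mk (curveIdeal k n q)),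
    ← map_natCast (Ideal.Quotient.mk (curveIdeal k n q)), ← map_pow, ← map_pow, ← map_mul,
    ← map_mul, ← map_mul, ← map_mul, Ideal.Quotient.eq] at h
  obtain ⟨c, hc⟩ := Ideal.mem_span_singleton.1 h
  have hX : (X 0 : MvPolynomial (Fin 2) k) ^ n = X 0 ^ (n - 1) * X 0 := by
    rw [← pow_succ, Nat.sub_add_cancel (by omega)]
  have hY : (X 1 : MvPolynomial (Fin 2) k) ^ q = X 1 ^ (q - 1) * X 1 := by
    rw [← pow_succ, Nat.sub_add_cancel (by omega)]
  have h1 : X 0 ^ (n - 1) * ((n : MvPolynomial (Fin 2) k) * F - c * X 0) = X 1 ^ (q - 1) * ((q : MvPolynomial (Fin 2) k) * G - c * X 1) := by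
    linear_combination hc + c * hX - c * hY
  obtain ⟨e, he⟩ := X_pow_dvd_of_X_pow_mul_eq (by decide) h1
  have h2 : (q : MvPolynomial (Fin 2) k) * G - c * X 1 = X 0 ^ (n - 1) * e := by
    apply (isRegular_X_pow (R := k) (n := (1 : Fin 2)) (q - 1)).left
    change X 1 ^ (q - 1) * _ = X 1 ^ (q - 1) * _
    rw [← h1, he]
    ring
  have h3 := congrArg (Ideal.Quotient.mk (curveIdeal k n q)) he
  have h4 := congrArg (Ideal.Quotient.mk (curveIdeal k n q)) h2
  simp only [map_sub, map_mul, map_pow, map_natCast, hF, hG] at h3 h4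
  have hn1 : (n : CurveRing k n q) * algebraMap k _ n' = 1 := by
    rw [← map_natCast (algebraMap k (CurveRing k n q)), ← map_mul, hn', map_one]
  have hq1 : (q : CurveRing k n q) * algebraMap k _ q' = 1 := by
    rw [← map_natCast (algebraMap k (CurveRing k n q)), ← map_mul, hq', map_one]
  generalize algebraMap k (CurveRing k n q) n' = n' at hn1
  generalize algebraMap k (CurveRing k n q) q' = q' at hq1
  refine ⟨n' * q' * Ideal.Quotient.mk _ c, n' * q' * Ideal.Quotient.mk _ e, ?_, ?_⟩
  · rw [curveX, curveY] at *
    linear_combination n' * h3 - δ (Ideal.Quotient.mk _ (X 0)) * hn1 -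
      n' * (Ideal.Quotient.mk _ c * Ideal.Quotient.mk _ (X 0) +
        Ideal.Quotient.mk _ e * Ideal.Quotient.mk _ (X 1) ^ (q - 1)) * hq1
  · rw [curveX, curveY] at *
    linear_combination q' * h4 - δ (Ideal.Quotient.mk _ (X 1)) * hq1 -
      q' * (Ideal.Quotient.mk _ c * Ideal.Quotient.mk _ (X 1) +
        Ideal.Quotient.mk _ e * Ideal.Quotient.mk _ (X 0) ^ (n - 1)) * hn1

/-- `y ^ j` does not lie in `⟨x, y ^ (j + 1)⟩` for `j < q`. -/
theorem curveY_pow_ne [Nontrivial k] (hn : n ≠ 0) {j : ℕ} (hj : j < q) (a b : CurveRing k n q) :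
    curveY k n q ^ j ≠ curveX k n q * a + curveY k n q ^ (j + 1) * b := by
  intro h
  obtain ⟨e, rfl⟩ := Nat.exists_eq_add_of_lt hj
  have hX : curveX k n (j + e + 1) ^ (n - 1) * curveX k n (j + e + 1) =
      curveY k n (j + e + 1) ^ (j + e + 1) := by
    rw [← pow_succ, Nat.sub_add_cancel (by omega), curveX_pow]
  have key : curveX k n (j + e + 1) ^ (n - 1) *
      Polynomial.aeval (curveY k n (j + e + 1)) (Polynomial.X ^ j : Polynomial k) =
      curveY k n (j + e + 1) ^ (j + 1) * (curveY k n (j + e + 1) ^ e * a +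
        curveX k n (j + e + 1) ^ (n - 1) * b) := by
    rw [map_pow, Polynomial.aeval_X]
    linear_combination curveX k n (j + e + 1) ^ (n - 1) * h + a * hX
  have := coeff_eq_zero_of_curveX_pow_mul_eq (by omega) (by omega) key (Nat.lt_succ_self j)
  simp at this

end Derivations

/-! ### Leaps -/

section Leaps

variable {k A : Type*} [CommRing k] [CommRing A] [Algebra k A]

theorem not_hasLeap_of_eq {l : ℕ} (h : 1 < l → IDer k A l = IDer k A ((l - 1 : ℕ) : ℕ∞)) :
    ¬ HasLeap k A l := fun hl => hl.2.ne (h hl.1)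

theorem hasLeap_iff_of_chain_two {u : ℕ} {S T : Set (Derivation k A A)} (hu : 1 < u) (hTS : T ⊂ S)
    (hS : ∀ i : ℕ∞, 1 ≤ i → i < u → IDer k A i = S) (hT : ∀ i : ℕ∞, u ≤ i → IDer k A i = T)
    (l : ℕ) : HasLeap k A l ↔ l = u := by
  constructor
  · intro h
    by_contra hne
    refine not_hasLeap_of_eq (fun h1 => ?_) h
    rcases Nat.lt_or_gt_of_ne hne with hlt | hgt
    · rw [hS l (by exact_mod_cast h1.le) (by exact_mod_cast hlt),
        hS _ (by exact_mod_cast (by omega)) (by exact_mod_cast (by omega))]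
    · rw [hT l (by exact_mod_cast hgt.le), hT _ (by exact_mod_cast (by omega))]
  · rintro rfl
    refine ⟨hu, ?_⟩
    rwa [hT l le_rfl, hS _ (by exact_mod_cast (by omega)) (by exact_mod_cast (by omega))]

theorem hasLeap_iff_of_chain_three {u v : ℕ} {S T U : Set (Derivation k A A)} (hu : 1 < u)
    (huv : u < v) (hTS : T ⊂ S) (hUT : U ⊂ T)
    (hS : ∀ i : ℕ∞, 1 ≤ i → i < u → IDer k A i = S)
    (hT : ∀ i : ℕ∞, u ≤ i → i < v → IDer k A i = T) (hU : ∀ i : ℕ∞, v ≤ i → IDer k A i = U)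
    (l : ℕ) : HasLeap k A l ↔ l = u ∨ l = v := by
  constructor
  · intro h
    by_contra! hne
    refine not_hasLeap_of_eq (fun h1 => ?_) h
    rcases Nat.lt_or_gt_of_ne hne.1 with hlt | hgt
    · rw [hS l (by exact_mod_cast h1.le) (by exact_mod_cast hlt),
        hS _ (by exact_mod_cast (by omega)) (by exact_mod_cast (by omega))]
    rcases Nat.lt_or_gt_of_ne hne.2 with hlt | hgt'
    · rw [hT l (by exact_mod_cast hgt.le) (by exact_mod_cast hlt),
        hT _ (by exact_mod_cast (by omega)) (by exact_mod_cast (by omega))]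
    · rw [hU l (by exact_mod_cast hgt'.le), hU _ (by exact_mod_cast (by omega))]
  · rintro (rfl | rfl)
    · refine ⟨hu, ?_⟩
      rwa [hT l le_rfl (by exact_mod_cast huv),
        hS _ (by exact_mod_cast (by omega)) (by exact_mod_cast (by omega))]
    · refine ⟨hu.trans huv, ?_⟩
      rwa [hU l le_rfl, hT _ (by exact_mod_cast (by omega)) (by exact_mod_cast (by omega))]

end Leaps

/-! ### The modules of integrable derivations for `p ∣ n` -/

section WildCurve

variable {k : Type*} [CommRing k] {n q : ℕ}
  {d : Derivation k (CurveRing k n q) (CurveRing k n q)}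

theorem derivation_eq_smul (hx : d (curveX k n q) = 1) (hy : d (curveY k n q) = 0)
    {δ : Derivation k (CurveRing k n q) (CurveRing k n q)} (hδ : δ (curveY k n q) = 0) :
    δ = δ (curveX k n q) • d := by
  refine curve_derivation_ext ?_ ?_
  · rw [Derivation.smul_apply, hx, smul_eq_mul, mul_one]
  · rw [Derivation.smul_apply, hy, smul_zero, hδ]

theorem mem_span_smul_iff (hx : d (curveX k n q) = 1) (hy : d (curveY k n q) = 0) {j : ℕ}
    {δ : Derivation k (CurveRing k n q) (CurveRing k n q)} (hδ : δ (curveY k n q) = 0) :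
    δ ∈ Submodule.span (CurveRing k n q) {curveX k n q • d, curveY k n q ^ j • d} ↔
      ∃ b c, δ (curveX k n q) = curveX k n q * b + curveY k n q ^ j * c := by
  rw [Submodule.mem_span_pair]
  constructor
  · rintro ⟨b, c, rfl⟩
    refine ⟨b, c, ?_⟩
    simp only [Derivation.add_apply, Derivation.smul_apply, hx, smul_eq_mul]
    ring
  · rintro ⟨b, c, h⟩
    refine ⟨b, c, ?_⟩
    rw [derivation_eq_smul hx hy hδ, h]
    ext f
    simp only [Derivation.add_apply, Derivation.smul_apply, smul_eq_mul]
    ring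

theorem span_smul_ssubset_span_smul [Nontrivial k] (hn : n ≠ 0)
    (hx : d (curveX k n q) = 1) (hy : d (curveY k n q) = 0) {j : ℕ} (hj : j < q) :
    (Submodule.span (CurveRing k n q) {curveX k n q • d, curveY k n q ^ (j + 1) • d} :
        Set (Derivation k (CurveRing k n q) (CurveRing k n q))) ⊂
      (Submodule.span (CurveRing k n q) {curveX k n q • d, curveY k n q ^ j • d} :
        Set (Derivation k (CurveRing k n q) (CurveRing k n q))) := by
  refine SetLike.coe_ssubset_coe.2 (lt_of_le_of_ne (Submodule.span_le.2 ?_) fun h => ?_)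
  · rintro _ (rfl | rfl)
    · exact Submodule.subset_span (Or.inl rfl)
    · refine (mem_span_smul_iff hx hy (by rw [Derivation.smul_apply, hy, smul_zero])).2
        ⟨0, curveY k n q, ?_⟩
      rw [Derivation.smul_apply, hx, smul_eq_mul, mul_one]
      ring
  · have h1 : curveY k n q ^ j • d ∈
        Submodule.span (CurveRing k n q) {curveX k n q • d, curveY k n q ^ j • d} :=
      Submodule.subset_span (Or.inr rfl)
    rw [← h, mem_span_smul_iff hx hy (by rw [Derivation.smul_apply, hy, smul_zero])] at h1
    obtain ⟨b, c, hbc⟩ := h1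
    rw [Derivation.smul_apply, hx, smul_eq_mul, mul_one] at hbc
    exact curveY_pow_ne hn hj b c hbc

theorem span_smul_ssubset_span_singleton [Nontrivial k] (hn : n ≠ 0) (hq : q ≠ 0)
    (hx : d (curveX k n q) = 1) (hy : d (curveY k n q) = 0) {j : ℕ} (hj : j ≠ 0) :
    (Submodule.span (CurveRing k n q) {curveX k n q • d, curveY k n q ^ j • d} :
        Set (Derivation k (CurveRing k n q) (CurveRing k n q))) ⊂
      (Submodule.span (CurveRing k n q) {d} :
        Set (Derivation k (CurveRing k n q) (CurveRing k n q))) := by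
  have hd : d ∈ Submodule.span (CurveRing k n q) {d} := Submodule.mem_span_singleton_self d
  refine SetLike.coe_ssubset_coe.2 (lt_of_le_of_ne (Submodule.span_le.2 ?_) fun h => ?_)
  · rintro _ (rfl | rfl)
    · exact Submodule.smul_mem _ _ hd
    · exact Submodule.smul_mem _ _ hd
  · rw [← h, mem_span_smul_iff hx hy hy, hx] at hd
    obtain ⟨b, c, hbc⟩ := hd
    obtain ⟨j, rfl⟩ : ∃ i, j = i + 1 := ⟨j - 1, by omega⟩
    refine curveY_pow_ne hn (Nat.pos_of_ne_zero hq) b (curveY k n q ^ j * c) ?_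
    rw [pow_zero, hbc]
    ring

variable {p : ℕ} [Fact p.Prime] [CharP k p] {a s j : ℕ}

theorem derivation_curveY_eq_zero (hn : n ≠ 0) (hpn : p ∣ n) (hq : ¬ p ∣ q)
    (δ : Derivation k (CurveRing k n q) (CurveRing k n q)) : δ (curveY k n q) = 0 := by
  have hq0 : q ≠ 0 := by rintro rfl; simp at hq
  have := charP_curveRing (k := k) (p := p) hn hq0
  have h := derivation_curve_relation δ
  rw [(CharP.cast_eq_zero_iff (CurveRing k n q) p n).2 hpn, zero_mul, zero_mul] at h
  apply curveY_pow_cancel hq0 (q - 1)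
  apply (isUnit_natCast_curveRing k (n := n) hq).mul_left_cancel
  rw [mul_zero, mul_zero, h]
  ring

theorem smul_curveX_mem_IDer (hn : n ≠ 0) (hpn : p ∣ n) (hq : ¬ p ∣ q)
    (hx : d (curveX k n q) = 1) (hy : d (curveY k n q) = 0) :
    curveX k n q • d ∈ IDer k (CurveRing k n q) ⊤ := by
  have hq0 : q ≠ 0 := by rintro rfl; simp at hq
  have := charP_curveRing (k := k) (p := p) hn hq0
  obtain ⟨q', hq'⟩ := (isUnit_natCast_curveRing k (n := n) (q := q) hq).exists_left_inv
  have h : ((q : CurveRing k n q) * curveX k n q) • d ∈ IDer k (CurveRing k n q) ⊤ := by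
    apply mem_IDer_of_euler
    · rw [Derivation.smul_apply, hx, smul_eq_mul, mul_one]
    · rw [Derivation.smul_apply, hy, smul_zero,
        (CharP.cast_eq_zero_iff (CurveRing k n q) p n).2 hpn, zero_mul]
  have h2 : curveX k n q • d = q' • (((q : CurveRing k n q) * curveX k n q) • d) := by
    apply Derivation.ext
    intro f
    simp only [Derivation.smul_apply, smul_eq_mul]
    linear_combination -(curveX k n q * d f) * hq'
  rw [h2]
  exact smul_mem_IDer q' h

theorem IDer_eq_span_smul (hn : n ≠ 0) (hpn : p ∣ n) (hq : ¬ p ∣ q)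
    (hx : d (curveX k n q) = 1) (hy : d (curveY k n q) = 0) {i : ℕ∞} (hi : 1 ≤ i)
    (h1 : curveY k n q ^ j • d ∈ IDer k (CurveRing k n q) i)
    (h2 : ∀ δ ∈ IDer k (CurveRing k n q) i,
      ∃ b c, δ (curveX k n q) = curveX k n q * b + curveY k n q ^ j * c) :
    IDer k (CurveRing k n q) i =
      Submodule.span (CurveRing k n q) {curveX k n q • d, curveY k n q ^ j • d} := by
  refine Set.Subset.antisymm (fun δ hδ => ?_) (span_subset_IDer hi ?_)
  · exact (mem_span_smul_iff hx hy (derivation_curveY_eq_zero hn hpn hq δ)).2 (h2 δ hδ)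
  · rintro _ (rfl | rfl)
    · exact IDer_anti hi le_top (smul_curveX_mem_IDer hn hpn hq hx hy)
    · exact h1

theorem IDer_eq_span_singleton (hns : n = p ^ a * s) (ha : a ≠ 0) (hn : n ≠ 0) (hq : ¬ p ∣ q)
    (hx : d (curveX k n q) = 1) (hy : d (curveY k n q) = 0) {i : ℕ∞} (hi : 1 ≤ i)
    (hip : i < (p ^ a : ℕ)) :
    IDer k (CurveRing k n q) i = Submodule.span (CurveRing k n q) {d} := by
  have hq0 : q ≠ 0 := by rintro rfl; simp at hq
  have hpn : p ∣ n := hns ▸ dvd_mul_of_dvd_left (dvd_pow_self p ha) s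
  refine Set.Subset.antisymm (fun δ _ => ?_) (span_subset_IDer hi ?_)
  · rw [derivation_eq_smul hx hy (derivation_curveY_eq_zero hn hpn hq δ)]
    exact Submodule.smul_mem _ _ (Submodule.mem_span_singleton_self d)
  · rintro _ rfl
    exact mem_IDer_of_lt hns hn hq0 hx hy hi hip

end WildCurve

theorem ceil_div_le_iff {p α q γ : ℕ} (hp : p ≠ 0)
    (hγ : γ = ⌈((q : ℚ) - 1) / (p : ℚ) ^ α⌉₊) (j : ℕ) : γ ≤ j ↔ q ≤ j * p ^ α + 1 := by
  have h : (0 : ℚ) < (p : ℚ) ^ α := by positivity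
  rw [hγ, Nat.ceil_le, div_le_iff₀ h, sub_le_iff_le_add]
  exact_mod_cast Iff.rfl

/- The induced derivations are written for logarithmic derivations of `k[x, y]`; that those at hand
are logarithmic is part of each conclusion. If `q < p` then `q - m = 0` and `β` takes the default
value `0`; this never matters, as `m = 1` and `2 ≤ q` give `q - m ≠ 0`. -/
theorem proposition2p1 {k : Type*} [CommRing k] [IsReduced k] (p : ℕ) [Fact p.Prime] [CharP k p]
    (n q α s m β γ : ℕ)
    (hα : α = padicValNat p n) (hs : s = n / p ^ α)
    (hm : m = q % p) (hβ : β = padicValNat p (q - m))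
    (hγ : γ = ⌈((q : ℚ) - 1) / (p : ℚ) ^ α⌉₊) :
    ((n : k) ≠ 0 → (q : k) ≠ 0 →
      ∃ (h₁ : delta1 k n q ∈ derLog k (curveIdeal k n q))
        (h₂ : delta2 k n q ∈ derLog k (curveIdeal k n q)),
        IDer k (CurveRing k n q) ⊤ = Set.univ ∧
        Submodule.span (CurveRing k n q) {derBar ⟨_, h₁⟩, derBar ⟨_, h₂⟩} = ⊤) ∧
    (p ∣ n → q = 1 →
      ∃ h : pderiv 0 ∈ derLog k (curveIdeal k n q),
        IDer k (CurveRing k n q) ⊤ = Set.univ ∧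
        Submodule.span (CurveRing k n q) {derBar ⟨_, h⟩} = ⊤) ∧
    (1 ≤ α → 1 ≤ m → 2 ≤ q →
      ∃ h : pderiv 0 ∈ derLog k (curveIdeal k n q),
        (∀ i : ℕ∞, 1 ≤ i → i < (p ^ α : ℕ) →
          IDer k (CurveRing k n q) i = Submodule.span (CurveRing k n q)
              {derBar ⟨_, h⟩}) ∧
        (s = 1 ∧ α ≤ β ∧ m = 1 →
          (∀ i : ℕ∞, (p ^ α : ℕ) ≤ i → i < (p ^ (α + β) : ℕ) →
            IDer k (CurveRing k n q) i = Submodule.span (CurveRing k n q)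
              {derBar ((X 0 : MvPolynomial (Fin 2) k) • ⟨_, h⟩), derBar ((X 1 ^ γ : MvPolynomial (Fin 2) k) • ⟨_, h⟩)}) ∧
          (∀ i : ℕ∞, (p ^ (α + β) : ℕ) ≤ i →
            IDer k (CurveRing k n q) i = Submodule.span (CurveRing k n q)
              {derBar ((X 0 : MvPolynomial (Fin 2) k) • ⟨_, h⟩), derBar ((X 1 ^ (γ + 1) : MvPolynomial (Fin 2) k) • ⟨_, h⟩)}) ∧
          (∀ l : ℕ, HasLeap k (CurveRing k n q) l ↔ l = p ^ α ∨ l = p ^ (α + β))) ∧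
        (¬(s = 1 ∧ α ≤ β ∧ m = 1) →
          (∀ i : ℕ∞, (p ^ α : ℕ) ≤ i →
            IDer k (CurveRing k n q) i = Submodule.span (CurveRing k n q)
              {derBar ((X 0 : MvPolynomial (Fin 2) k) • ⟨_, h⟩), derBar ((X 1 ^ γ : MvPolynomial (Fin 2) k) • ⟨_, h⟩)}) ∧
          (∀ l : ℕ, HasLeap k (CurveRing k n q) l ↔ l = p ^ α))) := by
  have hp : p.Prime := Fact.out
  have hnt : Nontrivial k := CharP.nontrivial_of_char_ne_one (R := k) hp.ne_one
  refine ⟨fun hn hq => ?_, fun hpn hq => ?_, fun hα1 hm1 hq2 => ?_⟩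
  · have hn0 : n ≠ 0 := by rintro rfl; simp at hn
    have hq0 : q ≠ 0 := by rintro rfl; simp at hq
    have hnu : IsUnit (n : k) := (CharP.isUnit_natCast_iff hp).2
      fun h => hn ((CharP.cast_eq_zero_iff k p n).2 h)
    have hqu : IsUnit (q : k) := (CharP.isUnit_natCast_iff hp).2
      fun h => hq ((CharP.cast_eq_zero_iff k p q).2 h)
    have hX : (X 0 : MvPolynomial (Fin 2) k) ^ n = X 0 ^ (n - 1) * X 0 := by
      rw [← pow_succ, Nat.sub_add_cancel (by omega)]
    have hY : (X 1 : MvPolynomial (Fin 2) k) ^ q = X 1 ^ (q - 1) * X 1 := by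
      rw [← pow_succ, Nat.sub_add_cancel (by omega)]
    have h₁ : delta1 k n q ∈ derLog k (curveIdeal k n q) := by
      refine mem_derLog_span_singleton ⟨n * q, ?_⟩
      simp [delta1, Derivation.leibniz_pow, pderiv_X]
      linear_combination (-(n * q : MvPolynomial (Fin 2) k)) * hX + n * q * hY
    have h₂ : delta2 k n q ∈ derLog k (curveIdeal k n q) := by
      refine mem_derLog_span_singleton ⟨0, ?_⟩
      simp [delta2, Derivation.leibniz_pow, pderiv_X]
      ring
    have e₁x : derBar ⟨_, h₁⟩ (curveX k n q) = q * curveX k n q := by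
      rw [curveX, derBar_mk]
      simp [delta1, pderiv_X]
    have e₁y : derBar ⟨_, h₁⟩ (curveY k n q) = n * curveY k n q := by
      rw [curveY, derBar_mk]
      simp [delta1, pderiv_X]
    have e₂x : derBar ⟨_, h₂⟩ (curveX k n q) = q * curveY k n q ^ (q - 1) := by
      rw [curveX, derBar_mk]
      simp [delta2, pderiv_X, curveY]
    have e₂y : derBar ⟨_, h₂⟩ (curveY k n q) = n * curveX k n q ^ (n - 1) := by
      rw [curveY, derBar_mk]
      simp [delta2, pderiv_X, curveX]
    have htop : Submodule.span (CurveRing k n q) {derBar ⟨_, h₁⟩, derBar ⟨_, h₂⟩} = ⊤ := by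
      rw [eq_top_iff]
      intro δ _
      rw [Submodule.mem_span_pair]
      obtain ⟨a, b, hx, hy⟩ := exists_euler_hamiltonian hn0 hq0 hnu hqu δ
      refine ⟨a, b, curve_derivation_ext ?_ ?_⟩
      · simp only [Derivation.add_apply, Derivation.smul_apply, smul_eq_mul, e₁x, e₂x, hx]
      · simp only [Derivation.add_apply, Derivation.smul_apply, smul_eq_mul, e₁y, e₂y, hy]
    refine ⟨h₁, h₂, Set.eq_univ_of_univ_subset ?_, htop⟩
    rw [← Submodule.top_coe (R := CurveRing k n q), ← htop]
    refine span_subset_IDer le_top ?_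
    rintro _ (rfl | rfl)
    · exact mem_IDer_of_euler e₁x e₁y
    · refine mem_IDer_of_hamiltonian (.inl hn0) ?_ hq0 e₂x e₂y
      simpa using hqu.map (algebraMap k (CurveRing k n q))
  · have hnk : (n : k) = 0 := (CharP.cast_eq_zero_iff k p n).2 hpn
    have hnA : (n : CurveRing k n q) = 0 := by
      rw [← map_natCast (algebraMap k (CurveRing k n q)), hnk, map_zero]
    have h : pderiv 0 ∈ derLog k (curveIdeal k n q) := by
      refine mem_derLog_span_singleton ⟨0, ?_⟩
      rw [map_sub, Derivation.leibniz_pow, Derivation.leibniz_pow,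
        pderiv_X_of_ne (by decide : (1 : Fin 2) ≠ 0), ← Nat.cast_smul_eq_nsmul k n, hnk]
      simp
    have ex : derBar ⟨_, h⟩ (curveX k n q) = 1 := by
      rw [curveX, derBar_mk, pderiv_X_self, map_one]
    have ey : derBar ⟨_, h⟩ (curveY k n q) = 0 := by
      rw [curveY, derBar_mk, pderiv_X_of_ne (by decide : (1 : Fin 2) ≠ 0), map_zero]
    have htop : Submodule.span (CurveRing k n q) {derBar ⟨_, h⟩} = ⊤ := by
      rw [eq_top_iff]
      intro δ _
      have hδ : δ (curveY k n q) = 0 := by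
        have := derivation_curve_relation δ
        rw [hnA] at this
        simpa [hq] using this.symm
      rw [derivation_eq_smul ex ey hδ]
      exact Submodule.smul_mem _ _ (Submodule.mem_span_singleton_self _)
    refine ⟨h, Set.eq_univ_of_univ_subset ?_, htop⟩
    rw [← Submodule.top_coe (R := CurveRing k n q), ← htop]
    refine span_subset_IDer le_top ?_
    rintro _ rfl
    refine mem_IDer_of_hamiltonian (.inr hq) (by simp [hq]) (by omega) ?_ ?_
    · rw [ex]
      simp [hq]
    · rw [ey, hnA, zero_mul]
  · have hn0 : n ≠ 0 := by
      rintro rfl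
      simp at hα
      omega
    have hα0 : α ≠ 0 := by omega
    have hq0 : q ≠ 0 := by omega
    have hpq : ¬ p ∣ q := fun h => by
      rw [Nat.dvd_iff_mod_eq_zero, ← hm] at h
      omega
    have hdvd : p ^ α ∣ n := hα ▸ pow_padicValNat_dvd
    have hns : n = p ^ α * s := by rw [hs, Nat.mul_div_cancel' hdvd]
    have hps : ¬ p ∣ s := by
      rintro ⟨t, rfl⟩
      have h1 : p ^ (padicValNat p n + 1) ∣ n := ⟨t, by rw [← hα, pow_succ, mul_assoc, ← hns]⟩
      exact pow_succ_padicValNat_not_dvd hn0 h1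
    have hpn : p ∣ n := (dvd_pow_self p hα0).trans hdvd
    have hnk : (n : k) = 0 := (CharP.cast_eq_zero_iff k p n).2 hpn
    have hP : 1 < p ^ α := Nat.one_lt_pow hα0 hp.one_lt
    have h : pderiv 0 ∈ derLog k (curveIdeal k n q) := by
      refine mem_derLog_span_singleton ⟨0, ?_⟩
      rw [map_sub, Derivation.leibniz_pow, Derivation.leibniz_pow,
        pderiv_X_of_ne (by decide : (1 : Fin 2) ≠ 0), ← Nat.cast_smul_eq_nsmul k n, hnk]
      simp
    refine ⟨h, ?_⟩
    have hxbar : derBar ((X 0 : MvPolynomial (Fin 2) k) • (⟨_, h⟩ : derLog k _)) =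
      curveX k n q • derBar ⟨_, h⟩ := derBar_smul _ _
    have hybar : ∀ j, derBar ((X 1 ^ j : MvPolynomial (Fin 2) k) • (⟨_, h⟩ : derLog k _)) =
      curveY k n q ^ j • derBar ⟨_, h⟩ := fun j => by
        rw [derBar_smul, map_pow]
        rfl
    rw [hxbar, hybar, hybar]
    have ex : derBar ⟨_, h⟩ (curveX k n q) = 1 := by
      rw [curveX, derBar_mk, pderiv_X_self, map_one]
    have ey : derBar ⟨_, h⟩ (curveY k n q) = 0 := by
      rw [curveY, derBar_mk, pderiv_X_of_ne (by decide : (1 : Fin 2) ≠ 0), map_zero]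
    generalize derBar ⟨_, h⟩ = d at ex ey
    have hyx : ∀ j, (curveY k n q ^ j • d) (curveX k n q) = curveY k n q ^ j := fun j => by
      rw [Derivation.smul_apply, ex, smul_eq_mul, mul_one]
    have hyy : ∀ j, (curveY k n q ^ j • d) (curveY k n q) = 0 := fun j => by
      rw [Derivation.smul_apply, ey, smul_zero]
    have hle : ∀ j, γ ≤ j ↔ q ≤ j * p ^ α + 1 := ceil_div_le_iff hp.ne_zero hγ
    have hγq : q ≤ γ * p ^ α + 1 := (hle γ).1 le_rfl
    have hγ0 : γ ≠ 0 := by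
      intro h0
      have := (hle 0).1 h0.le
      omega
    have hlow : ∀ l < γ, l * p ^ α + 1 < q := fun l hl => not_le.1 fun h => hl.not_ge ((hle l).2 h)
    have hone : ∀ i : ℕ∞, (p ^ α : ℕ) ≤ i → 1 ≤ i := fun i hi =>
      le_trans (by exact_mod_cast hP.le) hi
    have hlev1 := fun (i : ℕ∞) (hi : 1 ≤ i) (hip : i < (p ^ α : ℕ)) =>
      IDer_eq_span_singleton hns hα0 hn0 hpq ex ey hi hip
    have hnec : ∀ i : ℕ∞, (p ^ α : ℕ) ≤ i → ∀ δ ∈ IDer k (CurveRing k n q) i,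
        ∃ b c, δ (curveX k n q) = curveX k n q * b + curveY k n q ^ γ * c := fun i hi δ hδ =>
      exists_eq_of_mem_IDer hns hps hpq (IDer_anti (by exact_mod_cast hP.le) hi hδ) hlow
    have hstrict := span_smul_ssubset_span_singleton hn0 hq0 ex ey hγ0
    refine ⟨hlev1, fun hexc => ?_, fun hexc => ?_⟩
    · obtain ⟨hs1, hαβ, hm1'⟩ := hexc
      have hnp : n = p ^ α := by rw [hns, hs1, mul_one]
      have hβ0 : β ≠ 0 := by omega
      have hq1 : q - m ≠ 0 := by omega
      have hβdvd : p ^ β ∣ q - m := hβ ▸ pow_padicValNat_dvd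
      obtain ⟨r, hr⟩ := hβdvd
      have hqr : q = 1 + p ^ β * r := by omega
      have hpr : ¬ p ∣ r := by
        rintro ⟨t, rfl⟩
        have h1 : p ^ (padicValNat p (q - m) + 1) ∣ q - m :=
          ⟨t, by rw [← hβ, pow_succ, mul_assoc, ← hr]⟩
        exact pow_succ_padicValNat_not_dvd hq1 h1
      have hγeq : γ * p ^ α + 1 = q := by
        obtain ⟨e, he⟩ := pow_dvd_pow p hαβ
        have h1 : q = e * r * p ^ α + 1 := by
          rw [hqr, he]
          ring
        have h2 : γ * p ^ α ≤ e * r * p ^ α := Nat.mul_le_mul_right _ ((hle _).2 h1.le)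
        omega
      have hγlt : γ < q := by
        have := Nat.le_mul_of_pos_right γ (show 0 < p ^ α by omega)
        omega
      have hPN : p ^ α < p ^ (α + β) := Nat.pow_lt_pow_right hp.one_lt (by omega)
      have hlev2 : ∀ i : ℕ∞, (p ^ α : ℕ) ≤ i → i < (p ^ (α + β) : ℕ) →
          IDer k (CurveRing k n q) i = Submodule.span (CurveRing k n q)
            {curveX k n q • d, curveY k n q ^ γ • d} := fun i hi hi' =>
        IDer_eq_span_smul hn0 hpn hpq ex ey (hone i hi)
          (mem_IDer_of_exceptional hnp hα0 hqr hγeq (hyx γ) (hyy γ) (hone i hi) hi') (hnec i hi)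
      have hlev3 : ∀ i : ℕ∞, (p ^ (α + β) : ℕ) ≤ i →
          IDer k (CurveRing k n q) i = Submodule.span (CurveRing k n q)
            {curveX k n q • d, curveY k n q ^ (γ + 1) • d} := fun i hi => by
        have hi1 : 1 ≤ i := hone i (le_trans (by exact_mod_cast hPN.le) hi)
        refine IDer_eq_span_smul hn0 hpn hpq ex ey hi1
          (IDer_anti hi1 le_top (mem_IDer_of_le hns hn0 hα0 hq0 hpq ?_ (hyx _) (hyy _)))
          fun δ hδ => exists_eq_of_mem_IDer_exceptional hnp hα0 hβ0 hpr hqr hγeq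
            (IDer_anti (by exact_mod_cast (by omega)) hi hδ)
        rw [add_mul]
        omega
      exact ⟨hlev2, hlev3, hasLeap_iff_of_chain_three hP hPN hstrict
        (span_smul_ssubset_span_smul hn0 ex ey hγlt) hlev1 hlev2 hlev3⟩
    · have hint : curveY k n q ^ γ • d ∈ IDer k (CurveRing k n q) ⊤ := by
        by_cases hγeq : γ * p ^ α + 1 = q
        -- if `γ p ^ α = q - 1`, then `q ≡ 1` modulo `p ^ α`, so `s ≠ 1` outside the exceptional case
        · have hm1' : m = 1 := by
            have : p ∣ γ * p ^ α := dvd_mul_of_dvd_right (dvd_pow_self p hα0) γ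
            rw [hm, ← hγeq, Nat.add_mod, Nat.mod_eq_zero_of_dvd this, zero_add, Nat.mod_mod,
              Nat.mod_eq_of_lt hp.one_lt]
          have hαβ : α ≤ β := by
            rw [hβ, ← padicValNat_dvd_iff_le (by omega), hm1', ← hγeq, Nat.add_sub_cancel]
            exact dvd_mul_left _ _
          have hs1 : s ≠ 1 := fun hs1 => hexc ⟨hs1, hαβ, hm1'⟩
          have hs0 : s ≠ 0 := by
            rintro rfl
            simp at hps
          exact mem_IDer_of_two_le hns hn0 hα0 (by omega) hq2 hpq hγeq (hyx γ) (hyy γ)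
        · exact mem_IDer_of_le hns hn0 hα0 hq0 hpq (by omega) (hyx γ) (hyy γ)
      have hlev2 : ∀ i : ℕ∞, (p ^ α : ℕ) ≤ i →
          IDer k (CurveRing k n q) i = Submodule.span (CurveRing k n q)
            {curveX k n q • d, curveY k n q ^ γ • d} := fun i hi =>
        IDer_eq_span_smul hn0 hpn hpq ex ey (hone i hi) (IDer_anti (hone i hi) le_top hint)
          (hnec i hi)
      exact ⟨hlev2, hasLeap_iff_of_chain_two hP hstrict hlev1 hlev2⟩
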